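/- Let $G$ be a finite-dimensional real (smooth) Lie group with Lie algebra $\mathfrak{g}$ and exponential map $\exp:\mathfrak{g}\to G$. Let $U_0\subset\mathfrak{g}$ be an open neighborhood of $0$ such that $V_0:=\exp(U_0)$ is open in $G$ and $\exp:U_0\to V_0$ is a diffeomorphism, and let $\log:V_0\to U_0$ be its inverse. Let $\|\cdot\|$ be a euclidean norm on $\mathfrak{g}$, i.e. the norm of an inner product. Write $\prod_{i=1}^m g_i:=g_1g_2\cdots g_m$. Then there are real constants $\epsilon_0$ and $c_0$ (depending only on $G$, on $U_0$, $V_0$, and on the norm) with the following properties. (i) $0<\epsilon_0\le 1$ and $0\le c_0$. (ii) If $\alpha_1,\dots,\alpha_m\in\mathfrak{g}$ satisfy $\sum_{i=1}^m\|\alpha_i\|<\epsilon_0$, then $$\prod_{i=1}^m\exp(\alpha_i)\in V_0,\qquad \Big\|\log\Big(\prod_{i=1}^m\exp(\alpha_i)\Big)\Big\|\le c_0\sum_{i=1}^m\|\alpha_i\|,$$ $$\Big\|\log\Big(\prod_{i=1}^m\exp(\alpha_i)\Big)-\sum_{i=1}^m\alpha_i\Big\|\le c_0\Big(\sum_{i=1}^m\|\alpha_i\|\Big)^2.$$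 (iii) If $\alpha_1,\alpha_2\in\mathfrak{g}$ satisfy $\|\alpha_1\|+\|\alpha_2\|<\epsilon_0$, then $\|[\alpha_1,\alpha_2]\|\le c_0\|\alpha_1\|\,\|\alpha_2\|$, the elements $\exp(\alpha_1)\exp(\alpha_2)$ and $\exp(\alpha_1)\exp(\alpha_2)\exp(\alpha_1)^{-1}\exp(\alpha_2)^{-1}$ lie in $V_0$, and $$\Big\|\log\big(\exp(\alpha_1)\exp(\alpha_2)\big)-\big(\alpha_1+\alpha_2+\tfrac12[\alpha_1,\alpha_2]\big)\Big\|\le c_0\|\alpha_1\|\,\|\alpha_2\|\,(\|\alpha_1\|+\|\alpha_2\|),$$ $$\Big\|\log\big(\exp(\alpha_1)\exp(\alpha_2)\exp(\alpha_1)^{-1}\exp(\alpha_2)^{-1}\big)-[\alpha_1,\alpha_2]\Big\|\le c_0\|\alpha_1\|\,\|\alpha_2\|\,(\|\alpha_1\|+\|\alpha_2\|).$$ (iv) If $\alpha_1,\dots,\alpha_m,\beta_1,\dots,\beta_m\in\mathfrak{g}$ satisfy $\sum_{i=1}^m(\|\alpha_i\|+\|\beta_i\|)<\epsilon_0$, then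 $$\Big\|\log\Big(\prod_{i=1}^m\exp(\alpha_i+\beta_i)\Big)-\log\Big(\prod_{i=1}^m\exp(\alpha_i)\Big)-\sum_{i=1}^m\beta_i\Big\|\le c_0\Big(\sum_{i=1}^m(\|\alpha_i\|+\|\beta_i\|)\Big)\Big(\sum_{i=1}^m\|\beta_i\|\Big),$$ $$\Big\|\log\Big(\prod_{i=1}^m\exp(\alpha_i+\beta_i)\Big)-\log\Big(\prod_{i=1}^m\exp(\alpha_i)\Big)\Big\|\le c_0\sum_{i=1}^m\|\beta_i\|.$$ (v) If $\alpha_1,\dots,\beta_m$ are as in (iv) and moreover $[\alpha_i,\alpha_j]=0$ for all $i,j$, then $$\Big\|\log\Big(\prod_{i=1}^m\exp(\alpha_i+\beta_i)\Big)-\sum_{i=1}^m(\alpha_i+\beta_i)\Big\|\le c_0\Big(\sum_{i=1}^m(\|\alpha_i\|+\|\beta_i\|)\Big)\Big(\sum_{i=1}^m\|\beta_i\|\Big).$$ -/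

import Mathlib

open scoped Manifold ContDiff

section LieExponential

variable {E : Type*} [NormedAddCommGroup E] [NormedSpace ℝ E] [FiniteDimensional ℝ E]
  {H : Type*} [TopologicalSpace H] (I : ModelWithCorners ℝ E H) [I.Boundaryless]
  {G : Type*} [TopologicalSpace G] [ChartedSpace H G] [Group G] [LieGroup I ∞ G]

/-- For every `v` in the Lie algebra, the left-invariant vector field of `v` has a global integral
curve through `1`. -/
theorem exists_isMIntegralCurve_mulInvariantVectorField (v : GroupLieAlgebra I G) :
    ∃ γ : ℝ → G, γ 0 = 1 ∧ IsMIntegralCurve (I := I) γ (mulInvariantVectorField v) := by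
  have h3 : LieGroup I (minSmoothness ℝ 3) G := by
    rw [minSmoothness_of_isRCLikeNormedField]; infer_instance
  have : CompleteSpace E := FiniteDimensional.complete ℝ E
  have : IsManifold I 1 G := IsManifold.of_le (n := ∞) (by simp)
  have : IsTopologicalGroup G := topologicalGroup_of_lieGroup I ∞
  have : T1Space G := I.t1Space G
  have hv : ContMDiff I I.tangent 1
      (fun g : G ↦ (⟨g, mulInvariantVectorField v g⟩ : TangentBundle I G)) :=
    (contMDiff_mulInvariantVectorField v).of_le
      (by rw [minSmoothness_of_isRCLikeNormedField]; exact one_le_two)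
  have hd : ∀ g h : G, MDifferentiableAt I I (fun b : G ↦ g * b) h := fun g h ↦
    ((contMDiff_mul_left (I := I) (n := ∞) (a := g)).mdifferentiable (by simp)) h
  have htr : ∀ g h : G, mfderiv I I (fun b : G ↦ g * b) h (mulInvariantVectorField v h) =
      mulInvariantVectorField v (g * h) := by
    intro g h
    have hc : (fun b : G ↦ g * h * b) = (fun b : G ↦ g * b) ∘ (fun b : G ↦ h * b) := by
      ext b; simp [mul_assoc]
    have hd' : MDifferentiableAt I I (fun b : G ↦ g * b) (h * 1) := hd g _
    have h1 := mfderiv_comp (1 : G) hd' (hd h 1)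
    rw [← hc] at h1
    have hk : ∀ k : G, k = h → ∀ w : E,
        (mfderiv I I (fun b : G ↦ g * b) h : E →L[ℝ] E) w =
          (mfderiv I I (fun b : G ↦ g * b) k : E →L[ℝ] E) w := by
      rintro k rfl w; rfl
    refine (hk (h * 1) (mul_one h) _).trans ?_
    exact (DFunLike.congr_fun h1 v).symm
  obtain ⟨γ, h0, hγ⟩ := exists_isMIntegralCurveAt_of_contMDiffAt_boundaryless (I := I) (t₀ := 0)
    (v := mulInvariantVectorField v) (x₀ := (1 : G)) hv.contMDiffAt
  obtain ⟨ε, hε, hγ⟩ := isMIntegralCurveAt_iff'.mp hγ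
  refine exists_isMIntegralCurve_of_isMIntegralCurveOn hv hε (fun g ↦ ?_) 1
  refine ⟨fun t ↦ g * γ t, by simp [h0], fun t ht ↦ ?_⟩
  have hγt := hγ t (by simpa [Real.ball_eq_Ioo] using ht)
  have h2 := (hd g (γ t)).hasMFDerivAt.comp_hasMFDerivWithinAt t
    (hγt.mono (s := Set.Ioo (-ε) ε) (by simp [Real.ball_eq_Ioo]))
  have e : ContinuousLinearMap.smulRight (1 : ℝ →L[ℝ] ℝ)
      (mulInvariantVectorField (I := I) v (g * γ t) : E) =
      (mfderiv I I (fun b : G ↦ g * b) (γ t) : E →L[ℝ] E).comp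
        (ContinuousLinearMap.smulRight (1 : ℝ →L[ℝ] ℝ)
          (mulInvariantVectorField (I := I) v (γ t) : E)) := by
    refine ContinuousLinearMap.ext fun r ↦ ?_
    refine (congrArg (fun w : E ↦ r • w) (htr g (γ t)).symm).trans ?_
    exact ((mfderiv I I (fun b : G ↦ g * b) (γ t) : E →L[ℝ] E).map_smul r
      (mulInvariantVectorField (I := I) v (γ t) : E)).symm
  exact HasMFDerivWithinAt.congr_mfderiv h2 e.symm

/-- The exponential map of a Lie group: `lieExp I v` is the value at time `1` of the integral curve
through `1` of the left-invariant vector field of `v`. -/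
noncomputable def lieExp (v : GroupLieAlgebra I G) : G :=
  (exists_isMIntegralCurve_mulInvariantVectorField I v).choose 1

/-- The choice of the integral curve in `lieExp` is immaterial. -/
theorem lieExp_eq_of_isMIntegralCurve (v : GroupLieAlgebra I G) (γ : ℝ → G) (h0 : γ 0 = 1)
    (hγ : IsMIntegralCurve (I := I) γ (mulInvariantVectorField v)) : lieExp I v = γ 1 := by
  have h3 : LieGroup I (minSmoothness ℝ 3) G := by
    rw [minSmoothness_of_isRCLikeNormedField]; infer_instance
  have : CompleteSpace E := FiniteDimensional.complete ℝ E
  have : IsManifold I 1 G := IsManifold.of_le (n := ∞) (by simp)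
  have : IsTopologicalGroup G := topologicalGroup_of_lieGroup I ∞
  have : T1Space G := I.t1Space G
  have hv : ContMDiff I I.tangent 1
      (fun g : G ↦ (⟨g, mulInvariantVectorField v g⟩ : TangentBundle I G)) :=
    (contMDiff_mulInvariantVectorField v).of_le
      (by rw [minSmoothness_of_isRCLikeNormedField]; exact one_le_two)
  have hs := (exists_isMIntegralCurve_mulInvariantVectorField I v).choose_spec
  have := isMIntegralCurve_Ioo_eq_of_contMDiff_boundaryless (t₀ := 0) hv hs.2 hγ
    (by rw [hs.1, h0])
  exact congrFun this 1

/-- The logarithm attached to a set `U` on which the exponential map is injective: the inverse of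
`lieExp I` restricted to `U`. Its values outside `lieExp I '' U` are irrelevant. -/
noncomputable def lieLog (U : Set (GroupLieAlgebra I G)) : G → GroupLieAlgebra I G :=
  Function.invFunOn (lieExp I) U

/-- `U` is an open neighborhood of `0` in the Lie algebra, `V = exp U` is open in `G`, and
`exp : U → V` is a diffeomorphism, with inverse `lieLog I U`. The Lie algebra carries its smooth
structure of a finite-dimensional vector space: it is `E` as a topological vector space. -/
structure IsLogDomain (U : Set (GroupLieAlgebra I G)) (V : Set G) : Prop where
  isOpen_source : IsOpen U
  zero_mem : (0 : GroupLieAlgebra I G) ∈ U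
  image_eq : lieExp I '' U = V
  isOpen_target : IsOpen V
  injOn : Set.InjOn (lieExp I) U
  contMDiffOn_exp : ContMDiffOn (M := E) 𝓘(ℝ, E) I ∞ (fun v : E ↦ lieExp (G := G) I v) U
  contMDiffOn_log : ContMDiffOn (M' := E) I 𝓘(ℝ, E) ∞ (fun g : G ↦ (lieLog I U g : E)) V

end LieExponential

/-- The euclidean norm `‖v‖ = √⟨v, v⟩` of a (positive definite) inner product on a real vector
space. -/
noncomputable def euclideanNorm {V : Type*} [AddCommGroup V] [Module ℝ V]
    (ip : InnerProductSpace.Core ℝ V) (v : V) : ℝ :=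
  √(ip.inner v v)

open scoped Topology

/-- A group `G` with an exponential map `e` and a logarithm `l` defined on `V₀`, subject to the
second and third order estimates of the Baker-Campbell-Hausdorff formula in the ball of
radius `r`, where `2 • B` is the Lie bracket. -/
structure LogEstimates {V G : Type*} [AddCommGroup V] [Module ℝ V] [Group G] (N : Seminorm ℝ V)
    (B : V →ₗ[ℝ] V →ₗ[ℝ] V) (e : V → G) (l : G → V) (V₀ : Set G) (r C : ℝ) : Prop where
  r_pos : 0 < r
  r_le_one : r ≤ 1
  C_nonneg : 0 ≤ C
  C_mul_r_le : 16 * (C * r) ≤ 1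
  definite : ∀ x, N x = 0 → x = 0
  log_exp : ∀ x, N x < r → l (e x) = x
  exp_mem : ∀ x, N x < r → e x ∈ V₀
  exp_log : ∀ g ∈ V₀, e (l g) = g
  exp_add_smul : ∀ (s t : ℝ) x, e ((s + t) • x) = e (s • x) * e (t • x)
  mul_mem : ∀ x y, N x < r → N y < r → e x * e y ∈ V₀
  lip_left : ∀ x x' y, N x < r → N x' < r → N y < r →
    N (l (e x * e y) - l (e x' * e y) - (x - x')) ≤ C * N (x - x') * N y
  lip_right : ∀ x y y', N x < r → N y < r → N y' < r →
    N (l (e x * e y) - l (e x * e y') - (y - y')) ≤ C * N x * N (y - y')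
  bch : ∀ x y, N x < r → N y < r →
    N (l (e x * e y) - (x + y + B x y)) ≤ C * N x * N y * (N x + N y)
  isAlt : B.IsAlt
  apply_le : ∀ x y, N x < r → N y < r → N (B x y) ≤ C * N x * N y

namespace LogEstimates

variable {V G : Type*} [AddCommGroup V] [Module ℝ V] [Group G] {N : Seminorm ℝ V}
  {B : V →ₗ[ℝ] V →ₗ[ℝ] V} {e : V → G} {l : G → V} {V₀ : Set G} {r C : ℝ}

theorem map_sum_le_sum {ι : Type*} (N : Seminorm ℝ V) (s : Finset ι) (f : ι → V) :
    N (∑ i ∈ s, f i) ≤ ∑ i ∈ s, N (f i) :=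
  Finset.le_sum_of_subadditive N (map_zero N).le (map_add_le_add N) s f

theorem map_add₃_le (N : Seminorm ℝ V) (x y z : V) : N (x + y + z) ≤ N x + N y + N z :=
  (map_add_le_add N _ _).trans (by gcongr; exact map_add_le_add N _ _)

theorem sum_add_le (N : Seminorm ℝ V) (m : ℕ) (α β : Fin m → V) :
    ∑ i, N (α i + β i) ≤ ∑ i, (N (α i) + N (β i)) :=
  Finset.sum_le_sum fun _ _ ↦ map_add_le_add N _ _

theorem seminorm_inv_smul (N : Seminorm ℝ V) (n : ℕ) (x : V) : N ((n : ℝ)⁻¹ • x) = N x / n := by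
  rw [map_smul_eq_mul, norm_inv, Real.norm_natCast, inv_mul_eq_div]

section

variable (h : LogEstimates N B e l V₀ r C)
include h

theorem exp_zero : e 0 = 1 := by
  have := h.exp_add_smul 0 0 0
  simpa using this

theorem exp_neg (x : V) : e (-x) = (e x)⁻¹ := by
  have := h.exp_add_smul (-1) 1 x
  rw [eq_inv_iff_mul_eq_one]
  simpa [h.exp_zero] using this.symm

theorem exp_nsmul (n : ℕ) (x : V) : e ((n : ℝ) • x) = e x ^ n := by
  induction n with
  | zero => simp [h.exp_zero]
  | succ n ih => rw [Nat.cast_succ, h.exp_add_smul, ih, one_smul, pow_succ]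

theorem log_one : l 1 = 0 := by
  rw [← h.exp_zero]; exact h.log_exp 0 (by simpa using h.r_pos)

theorem mul_lt {s : ℝ} (hs : s < r) : 16 * (C * s) ≤ 1 := by
  have := h.C_mul_r_le
  have := mul_le_mul_of_nonneg_left hs.le h.C_nonneg
  linarith

theorem log_mul_sub_le {x y : V} (hx : N x < r) (hy : N y < r) :
    N (l (e x * e y) - (x + y)) ≤ C * N x * N y := by
  have := h.lip_left x 0 y hx (by simpa using h.r_pos) hy
  rw [h.exp_zero, one_mul, h.log_exp y hy, sub_zero] at this
  rwa [← sub_sub, sub_right_comm]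

theorem log_mul_le {x y : V} (hx : N x < r) (hy : N y < r) :
    N (l (e x * e y)) ≤ 2 * (N x + N y) := by
  have h1 := h.log_mul_sub_le hx hy
  have h2 := map_add_le_add N (l (e x * e y) - (x + y)) (x + y)
  have h3 := map_add_le_add N x y
  have h4 := mul_le_mul_of_nonneg_right (h.mul_lt hx) (apply_nonneg N y)
  rw [sub_add_cancel] at h2
  nlinarith [apply_nonneg N x, apply_nonneg N y]

theorem log_mul_lip_left {x x' y : V} (hx : N x < r) (hx' : N x' < r) (hy : N y < r) :
    N (l (e x * e y) - l (e x' * e y)) ≤ 2 * N (x - x') := by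
  have h1 := h.lip_left x x' y hx hx' hy
  have h2 := map_add_le_add N (l (e x * e y) - l (e x' * e y) - (x - x')) (x - x')
  have h4 := mul_le_mul_of_nonneg_right (h.mul_lt hy) (apply_nonneg N (x - x'))
  rw [sub_add_cancel] at h2
  nlinarith [apply_nonneg N (x - x')]

theorem log_mul_lip_right {x y y' : V} (hx : N x < r) (hy : N y < r) (hy' : N y' < r) :
    N (l (e x * e y) - l (e x * e y')) ≤ 2 * N (y - y') := by
  have h1 := h.lip_right x y y' hx hy hy'
  have h2 := map_add_le_add N (l (e x * e y) - l (e x * e y') - (y - y')) (y - y')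
  have h4 := mul_le_mul_of_nonneg_right (h.mul_lt hx) (apply_nonneg N (y - y'))
  rw [sub_add_cancel] at h2
  nlinarith [apply_nonneg N (y - y')]

/-! ### Products -/

theorem log_prod_sub_le (m : ℕ) (α : Fin m → V) (hα : 2 * ∑ i, N (α i) < r) :
    (List.ofFn fun i ↦ e (α i)).prod ∈ V₀ ∧
      N (l (List.ofFn fun i ↦ e (α i)).prod - ∑ i, α i) ≤ 2 * C * (∑ i, N (α i)) ^ 2 := by
  induction m with
  | zero => simpa [h.log_one] using h.exp_zero ▸ h.exp_mem 0 (by simpa using h.r_pos)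
  | succ m ih =>
    rw [Fin.sum_univ_castSucc] at hα
    simp only [List.ofFn_succ', Fin.sum_univ_castSucc, List.concat_eq_append, List.prod_append,
      List.prod_singleton]
    set S := ∑ i : Fin m, N (α i.castSucc)
    set σ := ∑ i : Fin m, α i.castSucc
    set p := (List.ofFn fun i : Fin m ↦ e (α i.castSucc)).prod with hp
    set a := α (Fin.last m)
    have ha := apply_nonneg N a
    have hS : 0 ≤ S := Finset.sum_nonneg fun _ _ ↦ apply_nonneg _ _
    obtain ⟨hm, hle⟩ := ih (fun i ↦ α i.castSucc) (by linarith)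
    have hC := h.mul_lt (s := S) (by linarith)
    have hσ : N σ ≤ S := map_sum_le_sum N _ _
    have h1 := map_add_le_add N (l p - σ) σ
    rw [sub_add_cancel] at h1
    have hpS : N (l p) ≤ 2 * S := by nlinarith
    have h2 := h.log_mul_sub_le (x := l p) (y := a) (by linarith) (by linarith)
    have h3 := h.mul_mem (l p) a (by linarith) (by linarith)
    rw [h.exp_log p hm] at h2 h3
    refine ⟨h3, ?_⟩
    have h4 := map_add_le_add N (l (p * e a) - (l p + a)) (l p - σ)
    have h5 : l (p * e a) - (l p + a) + (l p - σ) = l (p * e a) - (σ + a) := by abel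
    rw [h5] at h4
    have h6 : C * N (l p) * N a ≤ C * (2 * S) * N a := by gcongr; exact h.C_nonneg
    have h7 : 0 ≤ C * (S * N a) := mul_nonneg h.C_nonneg (by positivity)
    have h8 : 0 ≤ C * (N a * N a) := mul_nonneg h.C_nonneg (by positivity)
    nlinarith

theorem log_prod_le (m : ℕ) (α : Fin m → V) (hα : 2 * ∑ i, N (α i) < r) :
    N (l (List.ofFn fun i ↦ e (α i)).prod) ≤ 2 * ∑ i, N (α i) := by
  have h1 := (h.log_prod_sub_le m α hα).2
  have h2 : N (∑ i, α i) ≤ ∑ i, N (α i) := map_sum_le_sum N _ _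
  have h3 := map_add_le_add N (l (List.ofFn fun i ↦ e (α i)).prod - ∑ i, α i) (∑ i, α i)
  have hS : 0 ≤ ∑ i, N (α i) := Finset.sum_nonneg fun _ _ ↦ apply_nonneg _ _
  have hC := h.mul_lt (s := ∑ i, N (α i)) (by linarith)
  rw [sub_add_cancel] at h3
  nlinarith

theorem log_prod_add_sub_le (m : ℕ) (α β : Fin m → V)
    (hα : 2 * ∑ i, (N (α i) + N (β i)) < r) :
    N (l (List.ofFn fun i ↦ e (α i + β i)).prod - l (List.ofFn fun i ↦ e (α i)).prod - ∑ i, β i) ≤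
      4 * C * (∑ i, (N (α i) + N (β i))) * ∑ i, N (β i) := by
  induction m with
  | zero => simp [h.log_one]
  | succ m ih =>
    have hα' := hα
    rw [Fin.sum_univ_castSucc] at hα
    have hx := h.log_prod_le m (fun i ↦ α i.castSucc)
    have hxm := h.log_prod_sub_le m (fun i ↦ α i.castSucc)
    have hy := h.log_prod_le m (fun i ↦ α i.castSucc + β i.castSucc)
    have hym := h.log_prod_sub_le m (fun i ↦ α i.castSucc + β i.castSucc)
    have hle1 := sum_add_le N m (fun i ↦ α i.castSucc) (fun i ↦ β i.castSucc)
    have hle2 : ∑ i : Fin m, N (α i.castSucc) ≤ ∑ i : Fin m, (N (α i.castSucc) + N (β i.castSucc)) :=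
      Finset.sum_le_sum fun _ _ ↦ le_add_of_nonneg_right (apply_nonneg _ _)
    have hle3 : ∑ i : Fin m, N (β i.castSucc) ≤ ∑ i : Fin m, (N (α i.castSucc) + N (β i.castSucc)) :=
      Finset.sum_le_sum fun _ _ ↦ le_add_of_nonneg_left (apply_nonneg _ _)
    have hβ : N (∑ i : Fin m, β i.castSucc) ≤ ∑ i : Fin m, N (β i.castSucc) := map_sum_le_sum N _ _
    have ih := ih (fun i ↦ α i.castSucc) (fun i ↦ β i.castSucc)
    simp only [List.ofFn_succ', Fin.sum_univ_castSucc, List.concat_eq_append, List.prod_append,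
      List.prod_singleton]
    set T := ∑ i : Fin m, (N (α i.castSucc) + N (β i.castSucc))
    set b := ∑ i : Fin m, N (β i.castSucc)
    set σ := ∑ i : Fin m, β i.castSucc
    set p := (List.ofFn fun i : Fin m ↦ e (α i.castSucc)).prod
    set q := (List.ofFn fun i : Fin m ↦ e (α i.castSucc + β i.castSucc)).prod
    set x := α (Fin.last m)
    set y := β (Fin.last m)
    have hx0 := apply_nonneg N x
    have hy0 := apply_nonneg N y
    have hb : 0 ≤ b := Finset.sum_nonneg fun _ _ ↦ apply_nonneg _ _
    have hp := hx (by linarith)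
    have hq := hy (by linarith)
    have hpm := (hxm (by linarith)).1
    have hqm := (hym (by linarith)).1
    have ih := ih (by linarith)
    have hC := h.mul_lt (s := T) (by linarith)
    have hxy := map_add_le_add N x y
    have h1 := h.lip_left (l q) (l p) (x + y) (by linarith) (by linarith) (by linarith)
    have h2 := h.lip_right (l p) (x + y) x (by linarith) (by linarith) (by linarith)
    rw [h.exp_log p hpm, h.exp_log q hqm] at h1
    rw [h.exp_log p hpm, add_sub_cancel_left] at h2
    have h3 := map_add_le_add N (l q - l p - σ) σ
    rw [sub_add_cancel] at h3
    have hd : N (l q - l p) ≤ 2 * b := by nlinarith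
    have h4 := map_add₃_le N
      (l (q * e (x + y)) - l (p * e (x + y)) - (l q - l p)) (l (p * e (x + y)) - l (p * e x) - y)
      (l q - l p - σ)
    rw [show l (q * e (x + y)) - l (p * e (x + y)) - (l q - l p) +
      (l (p * e (x + y)) - l (p * e x) - y) + (l q - l p - σ) =
      l (q * e (x + y)) - l (p * e x) - (σ + y) by abel] at h4
    have h5 : C * N (l q - l p) * N (x + y) ≤ C * (2 * b) * (N x + N y) := by
      gcongr; exact mul_nonneg h.C_nonneg (by positivity)
      exact h.C_nonneg
    have h6 : C * N (l p) * N y ≤ C * (2 * T) * N y := by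
      gcongr; exact h.C_nonneg; linarith
    have h7 : 0 ≤ C * (b * (N x + N y)) := mul_nonneg h.C_nonneg (by positivity)
    have h8 : 0 ≤ C * ((N x + N y) * N y) := mul_nonneg h.C_nonneg (by positivity)
    have h9 : 0 ≤ C * (T * N y) := mul_nonneg h.C_nonneg (mul_nonneg (by linarith) hy0)
    linarith

theorem log_prod_add_sub_le' (m : ℕ) (α β : Fin m → V)
    (hα : 2 * ∑ i, (N (α i) + N (β i)) < r) :
    N (l (List.ofFn fun i ↦ e (α i + β i)).prod - l (List.ofFn fun i ↦ e (α i)).prod) ≤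
      2 * ∑ i, N (β i) := by
  have h1 := h.log_prod_add_sub_le m α β hα
  have h2 : N (∑ i, β i) ≤ ∑ i, N (β i) := map_sum_le_sum N _ _
  have h3 := map_add_le_add N (l (List.ofFn fun i ↦ e (α i + β i)).prod -
    l (List.ofFn fun i ↦ e (α i)).prod - ∑ i, β i) (∑ i, β i)
  have hb : 0 ≤ ∑ i, N (β i) := Finset.sum_nonneg fun _ _ ↦ apply_nonneg _ _
  have hT : 0 ≤ ∑ i, (N (α i) + N (β i)) := Finset.sum_nonneg fun _ _ ↦ by positivity
  have hC := h.mul_lt (s := ∑ i, (N (α i) + N (β i))) (by linarith)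
  rw [sub_add_cancel] at h3
  nlinarith

/-! ### Commutators -/

theorem commutator (x y : V) (hxy : 4 * (N x + N y) < r) :
    e x * e y * (e x)⁻¹ * (e y)⁻¹ ∈ V₀ ∧
      N (l (e x * e y * (e x)⁻¹ * (e y)⁻¹) - (2 : ℝ) • B x y) ≤
        (2 + 8 * C) * (C * N x * N y * (N x + N y)) := by
  have hx0 := apply_nonneg N x
  have hy0 := apply_nonneg N y
  have hx : N x < r := by linarith
  have hy : N y < r := by linarith
  have hsum : ∑ i, N (![x, y, -x, -y] i) = 2 * (N x + N y) := by
    simp [Fin.sum_univ_four]; ring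
  have hprod : (List.ofFn fun i ↦ e (![x, y, -x, -y] i)).prod =
      e x * e y * (e x)⁻¹ * (e y)⁻¹ := by
    simp [List.ofFn_succ, h.exp_neg, mul_assoc]
  have hm := (h.log_prod_sub_le 4 ![x, y, -x, -y] (by rw [hsum]; linarith)).1
  have hk := h.log_prod_le 4 ![x, y, -x, -y] (by rw [hsum]; linarith)
  rw [hprod] at hm hk
  rw [hsum] at hk
  refine ⟨hm, ?_⟩
  set k := l (e x * e y * (e x)⁻¹ * (e y)⁻¹) with hkdef
  set z := l (e y * e x)
  have hz := h.log_mul_le hy hx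
  have hmul : e k * e z = e x * e y := by
    rw [h.exp_log _ hm, h.exp_log _ (h.mul_mem y x hy hx)]; group
  have h1 := h.log_mul_sub_le (x := k) (y := z) (by linarith) (by linarith)
  rw [hmul] at h1
  have h2 := h.bch x y hx hy
  have h3 := h.bch y x hy hx
  have hB : B y x = - B x y := by rw [h.isAlt.neg]
  rw [hB] at h3
  set f := l (e x * e y)
  set D := C * N x * N y * (N x + N y) with hD
  have h3' : N (z - (y + x + -B x y)) ≤ D := by rw [hD]; linarith
  have h4 : N (f - z - (2 : ℝ) • B x y) ≤ 2 * D := by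
    have := map_sub_le_add N (f - (x + y + B x y)) (z - (y + x + -B x y))
    rw [show f - (x + y + B x y) - (z - (y + x + -B x y)) = f - z - (2 : ℝ) • B x y by
      rw [two_smul]; abel] at this
    linarith
  have h5 : N (k - (2 : ℝ) • B x y) ≤ 2 * D + C * N k * N z := by
    have := map_sub_le_add N (f - z - (2 : ℝ) • B x y) (f - (k + z))
    rw [show f - z - (2 : ℝ) • B x y - (f - (k + z)) = k - (2 : ℝ) • B x y by abel] at this
    linarith
  have h6 : N ((2 : ℝ) • B x y) ≤ 2 * (C * N x * N y) := by
    rw [map_smul_eq_mul]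
    simpa using h.apply_le x y hx hy
  have h7 := map_add_le_add N (k - (2 : ℝ) • B x y) ((2 : ℝ) • B x y)
  rw [sub_add_cancel] at h7
  have hC := h.mul_lt (s := 4 * (N x + N y)) (by linarith)
  have hP : 0 ≤ C * N x * N y := mul_nonneg (mul_nonneg h.C_nonneg hx0) hy0
  have hk0 := apply_nonneg N k
  have h8 : C * N k * N z ≤ C * N k * (2 * (N x + N y)) := by
    gcongr
    · exact mul_nonneg h.C_nonneg hk0
    · linarith
  have hr1 := h.r_le_one
  have hD2 : 4 * D ≤ C * N x * N y := by nlinarith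
  have h9 : C * N k * (2 * (N x + N y)) ≤ N k / 32 := by nlinarith
  have h10 : N k ≤ 4 * (C * N x * N y) := by linarith
  have h11 : C * N k * (2 * (N x + N y)) ≤ C * (4 * (C * N x * N y)) * (2 * (N x + N y)) := by
    have := h.C_nonneg
    gcongr
  linarith

/-! ### Commuting elements -/

theorem log_mul_sub_le_of_comm {x y : V} (hx : N x < r) (hy : N y < r) (hB : B x y = 0) :
    N (l (e x * e y) - (x + y)) ≤ C * N x * N y * (N x + N y) := by
  simpa [hB] using h.bch x y hx hy

theorem conj_mem {x y : V} (hxy : 6 * (N x + N y) < r) :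
    e x * e y * e (-x) ∈ V₀ ∧ N (l (e x * e y * e (-x))) ≤ 6 * (N x + N y) := by
  have hx0 := apply_nonneg N x
  have hy0 := apply_nonneg N y
  have hm := h.mul_mem x y (by linarith) (by linarith)
  have hz := h.log_mul_le (x := x) (y := y) (by linarith) (by linarith)
  have hx' : N (-x) = N x := map_neg_eq_map N x
  have h1 := h.mul_mem (l (e x * e y)) (-x) (by linarith) (by linarith)
  have h2 := h.log_mul_le (x := l (e x * e y)) (y := -x) (by linarith) (by linarith)
  rw [h.exp_log _ hm] at h1 h2
  exact ⟨h1, by linarith⟩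

theorem conj_lip {x y y' : V} (hy : 6 * (N x + N y) < r) (hy' : 6 * (N x + N y') < r) :
    N (l (e x * e y * e (-x)) - l (e x * e y' * e (-x))) ≤ 4 * N (y - y') := by
  have hx0 := apply_nonneg N x
  have hy0 := apply_nonneg N y
  have hy0' := apply_nonneg N y'
  have hm := h.mul_mem x y (by linarith) (by linarith)
  have hm' := h.mul_mem x y' (by linarith) (by linarith)
  have hz := h.log_mul_le (x := x) (y := y) (by linarith) (by linarith)
  have hz' := h.log_mul_le (x := x) (y := y') (by linarith) (by linarith)
  have hx' : N (-x) = N x := map_neg_eq_map N x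
  have h1 := h.log_mul_lip_left (x := l (e x * e y)) (x' := l (e x * e y')) (y := -x)
    (by linarith) (by linarith) (by linarith)
  have h2 := h.log_mul_lip_right (x := x) (y := y) (y' := y')
    (by linarith) (by linarith) (by linarith)
  rw [h.exp_log _ hm, h.exp_log _ hm'] at h1
  linarith

theorem conj_sub_le_of_comm {x y : V} (hxy : 6 * (N x + N y) < r) (hB : B x y = 0) :
    N (l (e x * e y * e (-x)) - y) ≤ 4 * (C * N x * N y * (N x + N y)) := by
  have hx0 := apply_nonneg N x
  have hy0 := apply_nonneg N y
  have hB' : B y x = 0 := by rw [← h.isAlt.neg, hB, neg_zero]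
  have hm := h.mul_mem x y (by linarith) (by linarith)
  have hm' := h.mul_mem y x (by linarith) (by linarith)
  have hz := h.log_mul_le (x := x) (y := y) (by linarith) (by linarith)
  have hz' := h.log_mul_le (x := y) (y := x) (by linarith) (by linarith)
  have hx' : N (-x) = N x := map_neg_eq_map N x
  have h1 := h.log_mul_lip_left (x := l (e x * e y)) (x' := l (e y * e x)) (y := -x)
    (by linarith) (by linarith) (by linarith)
  have h2 := h.log_mul_sub_le_of_comm (x := x) (y := y) (by linarith) (by linarith) hB
  have h3 := h.log_mul_sub_le_of_comm (x := y) (y := x) (by linarith) (by linarith) hB'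
  rw [h.exp_log _ hm, h.exp_log _ hm', mul_assoc (e y), h.exp_neg, mul_inv_cancel, mul_one,
    h.log_exp y (by linarith), ← h.exp_neg] at h1
  have h4 := map_sub_le_add N (l (e x * e y) - (x + y)) (l (e y * e x) - (y + x))
  rw [show l (e x * e y) - (x + y) - (l (e y * e x) - (y + x)) =
    l (e x * e y) - l (e y * e x) by abel] at h4
  linarith

theorem conj_sub_le_of_comm_div {x y : V} (hxy : 6 * (N x + N y) < r) (hB : B x y = 0)
    {n : ℕ} (hn : n ≠ 0) :
    N (l (e x * e y * e (-x)) - y) ≤ 4 * (C * N x * N y * (N x + N y / n)) := by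
  have hx0 := apply_nonneg N x
  have hy0 := apply_nonneg N y
  have hn1 : (1 : ℝ) ≤ n := by exact_mod_cast Nat.one_le_iff_ne_zero.2 hn
  have hn0 : (n : ℝ) ≠ 0 := by positivity
  have hyn : N ((n : ℝ)⁻¹ • y) = N y / n := seminorm_inv_smul N n y
  have hyn' : N y / n ≤ N y := div_le_self hy0 hn1
  have hyn0 : 0 ≤ N y / n := by positivity
  have h1 := h.conj_sub_le_of_comm (x := x) (y := (n : ℝ)⁻¹ • y) (by linarith) (by simp [hB])
  have hm := (h.conj_mem (x := x) (y := (n : ℝ)⁻¹ • y) (by linarith)).1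
  rw [hyn] at h1
  set c := l (e x * e ((n : ℝ)⁻¹ • y) * e (-x))
  have hC := h.mul_lt (s := N x + N y) (by linarith)
  have h2 : N c ≤ 2 * (N y / n) := by
    have := map_add_le_add N (c - (n : ℝ)⁻¹ • y) ((n : ℝ)⁻¹ • y)
    rw [sub_add_cancel, hyn] at this
    have hr := h.r_le_one
    have h3 : 0 ≤ C * N x * (N y / n) := mul_nonneg (mul_nonneg h.C_nonneg hx0) hyn0
    have h4 : C * N x ≤ 1 / 16 := by nlinarith [mul_nonneg h.C_nonneg hy0]
    nlinarith
  have h3 : e ((n : ℝ) • c) = e x * e y * e (-x) := by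
    rw [h.exp_nsmul, h.exp_log _ hm, h.exp_neg, conj_pow, ← h.exp_nsmul, smul_inv_smul₀ hn0]
  have h4 : N ((n : ℝ) • c) ≤ 2 * N y := by
    rw [map_smul_eq_mul, Real.norm_natCast]
    calc n * N c ≤ n * (2 * (N y / n)) := by gcongr
      _ = 2 * N y := by field_simp
  rw [← h3, h.log_exp _ (by linarith),
    show (n : ℝ) • c - y = (n : ℝ) • (c - (n : ℝ)⁻¹ • y) by rw [smul_sub, smul_inv_smul₀ hn0],
    map_smul_eq_mul, Real.norm_natCast]
  calc n * N (c - (n : ℝ)⁻¹ • y) ≤ n * (4 * (C * N x * (N y / n) * (N x + N y / n))) := by gcongr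
    _ = _ := by field_simp

theorem eq_zero_of_forall_le_div {x : V} {K : ℝ} (hK : ∀ n : ℕ, n ≠ 0 → N x ≤ K / n) : x = 0 := by
  refine h.definite x (le_antisymm ?_ (apply_nonneg N x))
  refine ge_of_tendsto (tendsto_const_div_atTop_nhds_zero_nat K) ?_
  filter_upwards [Filter.eventually_ne_atTop 0] with n hn using hK n hn

theorem exp_commute {x y : V} (hxy : 42 * (N x + N y) < r) (hB : B x y = 0) :
    e x * e y = e y * e x := by
  have hx0 := apply_nonneg N x
  have hy0 := apply_nonneg N y
  set K := C * N x * N y * (N x + N y) with hK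
  suffices hs : l (e x * e y * e (-x)) - y = 0 by
    have hm := (h.conj_mem (x := x) (y := y) (by linarith)).1
    have h1 := h.exp_log _ hm
    rw [sub_eq_zero.1 hs, h.exp_neg, eq_mul_inv_iff_mul_eq] at h1
    exact h1.symm
  refine h.eq_zero_of_forall_le_div (K := 16 * K) fun n hn ↦ ?_
  have hn1 : (1 : ℝ) ≤ n := by exact_mod_cast Nat.one_le_iff_ne_zero.2 hn
  have hn0 : (n : ℝ) ≠ 0 := by positivity
  set u := (n : ℝ)⁻¹ • x with hu
  have hun : N u = N x / n := seminorm_inv_smul N n x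
  have hun' : N u ≤ N x := hun ▸ div_le_self hx0 hn1
  have h1 : N (l (e u * e y * e (-u)) - y) ≤ 4 * K / n ^ 2 := by
    refine (h.conj_sub_le_of_comm_div (x := u) (y := y) (by linarith) (by simp [hu, hB]) hn).trans
      (le_of_eq ?_)
    rw [hun, hK]; field_simp
  obtain ⟨hm, hlt⟩ := h.conj_mem (x := u) (y := y) (by linarith)
  set z := l (e u * e y * e (-u))
  have key : ∀ k : ℕ, k ≤ n →
      N (l (e ((k : ℝ) • u) * e y * e (-((k : ℝ) • u))) - y) ≤ k * (16 * K / n ^ 2) := by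
    intro k
    induction k with
    | zero => intro _; simp [h.exp_zero, h.log_exp y (by linarith)]
    | succ k ih =>
      intro hk
      have hkn : (k : ℝ) ≤ n := by exact_mod_cast (by omega : k ≤ n)
      have hku : N ((k : ℝ) • u) ≤ N x := by
        rw [map_smul_eq_mul, Real.norm_natCast, hun]
        calc (k : ℝ) * (N x / n) ≤ n * (N x / n) := by gcongr
          _ = N x := by field_simp
      have h2 := h.conj_lip (x := (k : ℝ) • u) (y := z) (y' := y) (by linarith) (by linarith)
      have h3 : e ((k : ℝ) • u) * e z * e (-((k : ℝ) • u)) =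
          e (((k + 1 : ℕ) : ℝ) • u) * e y * e (-(((k + 1 : ℕ) : ℝ) • u)) := by
        rw [h.exp_log _ hm, Nat.cast_succ, h.exp_neg, h.exp_neg, h.exp_neg, h.exp_add_smul,
          one_smul]
        group
      rw [h3] at h2
      have h4 := map_add_le_add N (l (e (((k + 1 : ℕ) : ℝ) • u) * e y *
        e (-(((k + 1 : ℕ) : ℝ) • u))) - l (e ((k : ℝ) • u) * e y * e (-((k : ℝ) • u))))
        (l (e ((k : ℝ) • u) * e y * e (-((k : ℝ) • u))) - y)
      rw [sub_add_sub_cancel] at h4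
      have h5 := ih (by omega)
      have h6 : 16 * K / (n : ℝ) ^ 2 = 4 * (4 * K / n ^ 2) := by ring
      push_cast at h4 h2 ⊢
      rw [add_mul, one_mul]
      linarith
  have := key n le_rfl
  rw [hu, smul_inv_smul₀ hn0] at this
  refine this.trans (le_of_eq ?_)
  field_simp

theorem exp_add_of_comm {x y : V} (hxy : 42 * (N x + N y) < r) (hB : B x y = 0) :
    e x * e y = e (x + y) := by
  have hx0 := apply_nonneg N x
  have hy0 := apply_nonneg N y
  have hm := h.mul_mem x y (by linarith) (by linarith)
  set K := C * N x * N y * (N x + N y) with hK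
  have hK0 : 0 ≤ K := mul_nonneg (mul_nonneg (mul_nonneg h.C_nonneg hx0) hy0) (by positivity)
  have hC := h.mul_lt (s := N x + N y) (by linarith)
  suffices hs : l (e x * e y) - (x + y) = 0 by
    rw [← sub_eq_zero.1 hs, h.exp_log _ hm]
  refine h.eq_zero_of_forall_le_div (K := K) fun n hn ↦ ?_
  have hn1 : (1 : ℝ) ≤ n := by exact_mod_cast Nat.one_le_iff_ne_zero.2 hn
  have hn0 : (n : ℝ) ≠ 0 := by positivity
  set u := (n : ℝ)⁻¹ • x with hu
  set v := (n : ℝ)⁻¹ • y with hv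
  have hun : N u = N x / n := seminorm_inv_smul N n x
  have hvn : N v = N y / n := seminorm_inv_smul N n y
  have hun' : N u ≤ N x := hun ▸ div_le_self hx0 hn1
  have hvn' : N v ≤ N y := hvn ▸ div_le_self hy0 hn1
  have huv : B u v = 0 := by simp [hu, hv, hB]
  have h1 := h.log_mul_sub_le_of_comm (x := u) (y := v) (by linarith) (by linarith) huv
  have h2 := h.mul_mem u v (by linarith) (by linarith)
  have h0 := h.log_mul_le (x := u) (y := v) (by linarith) (by linarith)
  set z := l (e u * e v)
  have hcomm : Commute (e u) (e v) := h.exp_commute (by linarith) huv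
  have h3 : e ((n : ℝ) • z) = e x * e y := by
    rw [h.exp_nsmul, h.exp_log _ h2, hcomm.mul_pow, ← h.exp_nsmul, ← h.exp_nsmul,
      smul_inv_smul₀ hn0, smul_inv_smul₀ hn0]
  have h4 : N ((n : ℝ) • z) ≤ 2 * (N x + N y) := by
    rw [map_smul_eq_mul, Real.norm_natCast]
    calc n * N z ≤ n * (2 * (N u + N v)) := by gcongr
      _ = 2 * (N x + N y) := by rw [hun, hvn]; field_simp
  rw [← h3, h.log_exp _ (by linarith), show (n : ℝ) • z - (x + y) = (n : ℝ) • (z - (u + v)) by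
    rw [smul_sub, smul_add, smul_inv_smul₀ hn0, smul_inv_smul₀ hn0], map_smul_eq_mul,
    Real.norm_natCast]
  calc n * N (z - (u + v)) ≤ n * (C * N u * N v * (N u + N v)) := by gcongr
    _ = K / n / n := by rw [hun, hvn, hK]; field_simp
    _ ≤ K / n := div_le_self (by positivity) hn1

theorem prod_exp_of_comm (m : ℕ) (α : Fin m → V) (hα : 42 * ∑ i, N (α i) < r)
    (hB : ∀ i j, B (α i) (α j) = 0) :
    (List.ofFn fun i ↦ e (α i)).prod = e (∑ i, α i) := by
  induction m with
  | zero => simp [h.exp_zero]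
  | succ m ih =>
    rw [Fin.sum_univ_castSucc] at hα
    simp only [List.ofFn_succ', Fin.sum_univ_castSucc, List.concat_eq_append, List.prod_append,
      List.prod_singleton]
    have ha := apply_nonneg N (α (Fin.last m))
    have hS := map_sum_le_sum N Finset.univ (fun i : Fin m ↦ α i.castSucc)
    rw [ih (fun i ↦ α i.castSucc) (by linarith) (fun i j ↦ hB _ _)]
    refine h.exp_add_of_comm (by linarith) ?_
    simp [hB]

theorem log_prod_add_sub_le_of_comm (m : ℕ) (α β : Fin m → V)
    (hα : 42 * ∑ i, (N (α i) + N (β i)) < r) (hB : ∀ i j, B (α i) (α j) = 0) :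
    N (l (List.ofFn fun i ↦ e (α i + β i)).prod - ∑ i, (α i + β i)) ≤
      4 * C * (∑ i, (N (α i) + N (β i))) * ∑ i, N (β i) := by
  have hT : 0 ≤ ∑ i, (N (α i) + N (β i)) := Finset.sum_nonneg fun _ _ ↦ by positivity
  have hle : ∑ i, N (α i) ≤ ∑ i, (N (α i) + N (β i)) :=
    Finset.sum_le_sum fun _ _ ↦ le_add_of_nonneg_right (apply_nonneg _ _)
  have hS := map_sum_le_sum N Finset.univ α
  have h1 := h.log_prod_add_sub_le m α β (by linarith)
  rwa [h.prod_exp_of_comm m α (by linarith) hB, h.log_exp _ (by linarith), sub_sub,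
    ← Finset.sum_add_distrib] at h1

theorem exists_constants (br : V → V → V) (hbr : ∀ x y, br x y = (2 : ℝ) • B x y) :
    ∃ ε₀ c₀ : ℝ, (0 < ε₀ ∧ ε₀ ≤ 1 ∧ 0 ≤ c₀) ∧
      (∀ (m : ℕ) (α : Fin m → V), ∑ i, N (α i) < ε₀ →
        (List.ofFn fun i ↦ e (α i)).prod ∈ V₀ ∧
        N (l (List.ofFn fun i ↦ e (α i)).prod) ≤ c₀ * ∑ i, N (α i) ∧
        N (l (List.ofFn fun i ↦ e (α i)).prod - ∑ i, α i) ≤ c₀ * (∑ i, N (α i)) ^ 2) ∧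
      (∀ x y : V, N x + N y < ε₀ →
        N (br x y) ≤ c₀ * N x * N y ∧ e x * e y ∈ V₀ ∧
        N (l (e x * e y) - (x + y + (1 / 2 : ℝ) • br x y)) ≤ c₀ * N x * N y * (N x + N y) ∧
        e x * e y * (e x)⁻¹ * (e y)⁻¹ ∈ V₀ ∧
        N (l (e x * e y * (e x)⁻¹ * (e y)⁻¹) - br x y) ≤ c₀ * N x * N y * (N x + N y)) ∧
      (∀ (m : ℕ) (α β : Fin m → V), ∑ i, (N (α i) + N (β i)) < ε₀ →
        N (l (List.ofFn fun i ↦ e (α i + β i)).prod - l (List.ofFn fun i ↦ e (α i)).prod -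
          ∑ i, β i) ≤ c₀ * (∑ i, (N (α i) + N (β i))) * ∑ i, N (β i) ∧
        N (l (List.ofFn fun i ↦ e (α i + β i)).prod - l (List.ofFn fun i ↦ e (α i)).prod) ≤
          c₀ * ∑ i, N (β i) ∧
        ((∀ i j, br (α i) (α j) = 0) →
          N (l (List.ofFn fun i ↦ e (α i + β i)).prod - ∑ i, (α i + β i)) ≤
            c₀ * (∑ i, (N (α i) + N (β i))) * ∑ i, N (β i))) := by
  have hC := h.C_nonneg
  have hr := h.r_pos
  have hr1 := h.r_le_one
  set c := 2 + 4 * C + (2 + 8 * C) * C with hc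
  have hCC : 0 ≤ (2 + 8 * C) * C := by positivity
  have hc2 : 2 ≤ c := by linarith
  have hc4 : 4 * C ≤ c := by linarith
  have hc8 : (2 + 8 * C) * C ≤ c := by linarith
  refine ⟨r / 42, c, ⟨by positivity, by linarith, by linarith⟩, ?_, ?_, ?_⟩
  · intro m α hα
    have hS : 0 ≤ ∑ i, N (α i) := Finset.sum_nonneg fun _ _ ↦ apply_nonneg _ _
    obtain ⟨h1, h2⟩ := h.log_prod_sub_le m α (by linarith)
    refine ⟨h1, (h.log_prod_le m α (by linarith)).trans (by gcongr), h2.trans ?_⟩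
    gcongr
    linarith
  · intro x y hxy
    have hx0 := apply_nonneg N x
    have hy0 := apply_nonneg N y
    obtain ⟨h1, h2⟩ := h.commutator x y (by linarith)
    refine ⟨?_, h.mul_mem x y (by linarith) (by linarith), ?_, h1, ?_⟩
    · rw [hbr, map_smul_eq_mul, Real.norm_ofNat]
      have := h.apply_le x y (by linarith) (by linarith)
      calc 2 * N (B x y) ≤ 2 * (C * N x * N y) := by gcongr
        _ = 2 * C * N x * N y := by ring
        _ ≤ c * N x * N y := by gcongr; linarith
    · rw [hbr, smul_smul, one_div, inv_mul_cancel₀ two_ne_zero, one_smul]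
      refine (h.bch x y (by linarith) (by linarith)).trans ?_
      gcongr
      linarith
    · rw [hbr]
      refine h2.trans ?_
      rw [← mul_assoc, ← mul_assoc, ← mul_assoc]
      gcongr
  · intro m α β hα
    have hT : 0 ≤ ∑ i, (N (α i) + N (β i)) := Finset.sum_nonneg fun _ _ ↦ by positivity
    have hb : 0 ≤ ∑ i, N (β i) := Finset.sum_nonneg fun _ _ ↦ apply_nonneg _ _
    refine ⟨(h.log_prod_add_sub_le m α β (by linarith)).trans (by gcongr),
      (h.log_prod_add_sub_le' m α β (by linarith)).trans (by gcongr), fun hB ↦ ?_⟩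
    refine (h.log_prod_add_sub_le_of_comm m α β (by linarith) fun i j ↦ ?_).trans (by gcongr)
    simpa [hbr] using hB i j

end

end LogEstimates

section Calculus

variable {X E F : Type*} [NormedAddCommGroup X] [NormedSpace ℝ X] [NormedAddCommGroup E]
  [NormedSpace ℝ E] [NormedAddCommGroup F] [NormedSpace ℝ F]

theorem ContDiffAt.exists_norm_sub_sub_fderiv_le {Φ : X → F} (hΦ : ContDiffAt ℝ 2 Φ 0) :
    ∃ δ > 0, ∃ K ≥ 0, ∀ p q : X, ‖p‖ < δ → ‖q‖ < δ →
      ‖Φ p - Φ q - fderiv ℝ Φ 0 (p - q)‖ ≤ K * max ‖p‖ ‖q‖ * ‖p - q‖ := by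
  obtain ⟨K, t, ht, hK⟩ := (hΦ.fderiv_right (m := 1) (by norm_num)).exists_lipschitzOnWith
  have hd : ∀ᶠ p in 𝓝 (0 : X), DifferentiableAt ℝ Φ p :=
    (hΦ.eventually (by simp)).mono fun p hp ↦ hp.differentiableAt (by simp)
  obtain ⟨δ, hδ, hball⟩ := Metric.eventually_nhds_iff.1 (hd.and ht)
  simp only [dist_zero_right] at hball
  refine ⟨δ, hδ, K, K.2, fun p q hp hq ↦ ?_⟩
  set ρ := max ‖p‖ ‖q‖
  have hρ : ρ < δ := max_lt hp hq
  have h := (convex_closedBall (0 : X) ρ).norm_image_sub_le_of_norm_hasFDerivWithin_le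
    (f := fun p ↦ Φ p - fderiv ℝ Φ 0 p) (f' := fun p ↦ fderiv ℝ Φ p - fderiv ℝ Φ 0)
    (C := K * ρ) (x := q) (y := p) ?_ ?_ (by simp [ρ]) (by simp [ρ])
  · refine le_trans (le_of_eq ?_) h
    rw [map_sub]
    congr 1
    abel
  · intro x hx
    rw [mem_closedBall_zero_iff] at hx
    exact ((hball (hx.trans_lt hρ)).1.hasFDerivAt.sub
      (fderiv ℝ Φ 0).hasFDerivAt).hasFDerivWithinAt
  · intro x hx
    rw [mem_closedBall_zero_iff] at hx
    have := hK.norm_sub_le (hball (hx.trans_lt hρ)).2 (mem_of_mem_nhds ht)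
    rw [sub_zero] at this
    exact this.trans (by gcongr)

/-- The derivative at the origin, in the first variable, of the partial derivative of `f` in the
second variable. -/
noncomputable def mixedDeriv (f : E × E → F) : E →L[ℝ] E →L[ℝ] F :=
  (fderiv ℝ (fun p ↦ (fderiv ℝ f p).comp (ContinuousLinearMap.inr ℝ E E)) 0).comp
    (ContinuousLinearMap.inl ℝ E E)

theorem ContDiffAt.exists_norm_sub_mixedDeriv_le {f : E × E → E} (hf : ContDiffAt ℝ 3 f 0)
    (h0 : ∀ᶠ y in 𝓝 0, f (0, y) = y) :
    ∃ δ > 0, ∃ K ≥ 0, ∀ x y y' : E, ‖x‖ < δ → ‖y‖ < δ → ‖y'‖ < δ →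
      ‖f (x, y) - f (x, y') - (y - y') - mixedDeriv f x (y - y')‖ ≤
        K * max ‖x‖ (max ‖y‖ ‖y'‖) * ‖x‖ * ‖y - y'‖ := by
  set P : E × E → E →L[ℝ] E := fun p ↦ (fderiv ℝ f p).comp (ContinuousLinearMap.inr ℝ E E) with hP
  have hP2 : ContDiffAt ℝ 2 P 0 :=
    (hf.fderiv_right (m := 2) (by norm_num)).clm_comp contDiffAt_const
  obtain ⟨δ₁, hδ₁, K, hK, hPK⟩ := hP2.exists_norm_sub_sub_fderiv_le
  have hd : ∀ᶠ p in 𝓝 (0 : E × E), DifferentiableAt ℝ f p :=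
    (hf.eventually (by simp)).mono fun p hp ↦ hp.differentiableAt (by simp)
  obtain ⟨δ₂, hδ₂, hdiff⟩ := Metric.eventually_nhds_iff.1 hd
  obtain ⟨δ₃, hδ₃, hid⟩ := Metric.eventually_nhds_iff.1 h0.eventually_nhds
  simp only [dist_zero_right] at hdiff hid
  have hpart : ∀ x y : E, ‖x‖ < δ₂ → ‖y‖ < δ₂ → HasFDerivAt (fun y ↦ f (x, y)) (P (x, y)) y :=
    fun x y hx hy ↦ (hdiff (y := (x, y)) (max_lt hx hy)).hasFDerivAt.comp y
      (hasFDerivAt_prodMk_right x y)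
  have hP0 : ∀ y : E, ‖y‖ < δ₂ → ‖y‖ < δ₃ → P (0, y) = ContinuousLinearMap.id ℝ E := by
    intro y hy hy3
    refine (hpart 0 y (by simpa using hδ₂) hy).unique ?_
    exact (hasFDerivAt_id y).congr_of_eventuallyEq (hid hy3)
  refine ⟨min δ₁ (min δ₂ δ₃), by positivity, K, hK, fun x y y' hx hy hy' ↦ ?_⟩
  simp only [lt_min_iff] at hx hy hy'
  set ρ := max ‖y‖ ‖y'‖ with hρ
  have h := (convex_closedBall (0 : E) ρ).norm_image_sub_le_of_norm_hasFDerivWithin_le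
    (f := fun y ↦ f (x, y) - y - mixedDeriv f x y)
    (f' := fun y ↦ P (x, y) - ContinuousLinearMap.id ℝ E - mixedDeriv f x)
    (C := K * max ‖x‖ ρ * ‖x‖) (x := y') (y := y) ?_ ?_ (by simp [ρ]) (by simp [ρ])
  · refine le_trans (le_of_eq ?_) h
    rw [map_sub]
    congr 1
    abel
  · intro z hz
    rw [mem_closedBall_zero_iff] at hz
    have hz2 : ‖z‖ < δ₂ := hz.trans_lt (max_lt hy.2.1 hy'.2.1)
    exact (((hpart x z hx.2.1 hz2).sub (hasFDerivAt_id z)).sub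
      (mixedDeriv f x).hasFDerivAt).hasFDerivWithinAt
  · intro z hz
    rw [mem_closedBall_zero_iff] at hz
    have hz1 : ‖z‖ < δ₁ := hz.trans_lt (max_lt hy.1 hy'.1)
    have hz2 : ‖z‖ < δ₂ := hz.trans_lt (max_lt hy.2.1 hy'.2.1)
    have hz3 : ‖z‖ < δ₃ := hz.trans_lt (max_lt hy.2.2 hy'.2.2)
    have h1 := hPK (x, z) (0, z) (max_lt hx.1 hz1) (max_lt (by simpa using hδ₁) hz1)
    rw [hP0 z hz2 hz3] at h1
    have h2 : ((x, z) : E × E) - (0, z) = ContinuousLinearMap.inl ℝ E E x := by simp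
    rw [h2] at h1
    refine h1.trans ?_
    have h3 : max ‖((x, z) : E × E)‖ ‖((0, z) : E × E)‖ ≤ max ‖x‖ ρ := by
      simp only [Prod.norm_mk, norm_zero]
      refine max_le (max_le_max le_rfl hz) (max_le (le_max_of_le_left (norm_nonneg _))
        (le_max_of_le_right hz))
    have h4 : ‖ContinuousLinearMap.inl ℝ E E x‖ = ‖x‖ := by simp
    rw [h4]
    gcongr

theorem mixedDeriv_isAlt {f : E × E → E} (hf : ContDiffAt ℝ 3 f 0)
    (h0 : ∀ᶠ y in 𝓝 0, f (0, y) = y) (h0' : ∀ᶠ x in 𝓝 0, f (x, 0) = x)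
    (hdiag : ∀ᶠ x in 𝓝 0, f (x, x) = (2 : ℝ) • x) (x : E) : mixedDeriv f x x = 0 := by
  obtain ⟨δ, hδ, K, hK, hle⟩ := hf.exists_norm_sub_mixedDeriv_le h0
  have hc : Filter.Tendsto (fun s : ℝ ↦ s • x) (𝓝[>] 0) (𝓝 0) := by
    refine tendsto_nhdsWithin_of_tendsto_nhds ?_
    have : Continuous fun s : ℝ ↦ s • x := by fun_prop
    simpa using this.tendsto 0
  have hball : ∀ᶠ y in 𝓝 (0 : E), ‖y‖ < δ := by
    simpa [Metric.ball, Filter.Eventually] using Metric.ball_mem_nhds (0 : E) hδ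
  have hev : ∀ᶠ s in 𝓝[>] (0 : ℝ), ‖mixedDeriv f x x‖ ≤ s * (K * ‖x‖ ^ 3) := by
    filter_upwards [hc.eventually hball, hc.eventually h0', hc.eventually hdiag,
      self_mem_nhdsWithin] with s h1 h2 h3 hs
    have hs : 0 < s := hs
    have h4 := hle (s • x) (s • x) 0 h1 h1 (by simpa using hδ)
    rw [h2, h3] at h4
    have h5 : (2 : ℝ) • s • x - s • x - (s • x - 0) - mixedDeriv f (s • x) (s • x - 0) =
        -((s * s) • mixedDeriv f x x) := by
      rw [sub_zero, two_smul, map_smul, map_smul, smul_apply, smul_smul]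
      abel
    rw [h5, norm_neg, norm_smul, sub_zero, norm_zero, max_eq_left (norm_nonneg _), max_self,
      norm_smul, Real.norm_of_nonneg hs.le, Real.norm_of_nonneg (by positivity)] at h4
    have h6 : s * s * ‖mixedDeriv f x x‖ ≤ s * s * (s * (K * ‖x‖ ^ 3)) := by
      refine h4.trans (le_of_eq ?_); ring
    exact le_of_mul_le_mul_left h6 (by positivity)
  have hlim : Filter.Tendsto (fun s : ℝ ↦ s * (K * ‖x‖ ^ 3)) (𝓝[>] 0) (𝓝 0) := by
    refine tendsto_nhdsWithin_of_tendsto_nhds ?_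
    have : Continuous fun s : ℝ ↦ s * (K * ‖x‖ ^ 3) := by fun_prop
    simpa using this.tendsto 0
  exact norm_le_zero_iff.1 (ge_of_tendsto hlim hev)

theorem ContDiffAt.exists_bch_bounds {f : E × E → E} (hf : ContDiffAt ℝ 3 f 0)
    (h0 : ∀ᶠ y in 𝓝 0, f (0, y) = y) (h0' : ∀ᶠ x in 𝓝 0, f (x, 0) = x) :
    ∃ δ > 0, ∃ L ≥ 0,
      (∀ x x' y : E, ‖x‖ < δ → ‖x'‖ < δ → ‖y‖ < δ →
        ‖f (x, y) - f (x', y) - (x - x')‖ ≤ L * ‖x - x'‖ * ‖y‖) ∧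
      (∀ x y y' : E, ‖x‖ < δ → ‖y‖ < δ → ‖y'‖ < δ →
        ‖f (x, y) - f (x, y') - (y - y')‖ ≤ L * ‖x‖ * ‖y - y'‖) ∧
      (∀ x y : E, ‖x‖ < δ → ‖y‖ < δ →
        ‖f (x, y) - (x + y + mixedDeriv f x y)‖ ≤ L * ‖x‖ * ‖y‖ * (‖x‖ + ‖y‖)) ∧
      ∀ x y : E, ‖mixedDeriv f x y‖ ≤ L * ‖x‖ * ‖y‖ := by
  have lip : ∀ {f : E × E → E}, ContDiffAt ℝ 3 f 0 → (∀ᶠ y in 𝓝 0, f (0, y) = y) →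
      ∃ δ > 0, ∃ L ≥ 0, ∀ x y y' : E, ‖x‖ < δ → ‖y‖ < δ → ‖y'‖ < δ →
        ‖f (x, y) - f (x, y') - (y - y')‖ ≤ L * ‖x‖ * ‖y - y'‖ := by
    intro f hf h0
    obtain ⟨δ, hδ, K, hK, hle⟩ := hf.exists_norm_sub_mixedDeriv_le h0
    refine ⟨δ, hδ, K * δ + ‖mixedDeriv f‖, by positivity, fun x y y' hx hy hy' ↦ ?_⟩
    have h1 := hle x y y' hx hy hy'
    have h2 := (mixedDeriv f).le_opNorm₂ x (y - y')
    have h3 : K * max ‖x‖ (max ‖y‖ ‖y'‖) * ‖x‖ * ‖y - y'‖ ≤ K * δ * ‖x‖ * ‖y - y'‖ := by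
      gcongr
      exact max_le hx.le (max_le hy.le hy'.le)
    have h4 := norm_le_norm_sub_add (f (x, y) - f (x, y') - (y - y')) (mixedDeriv f x (y - y'))
    linarith
  obtain ⟨δ, hδ, K, hK, hle⟩ := hf.exists_norm_sub_mixedDeriv_le h0
  obtain ⟨δ₁, hδ₁, L₁, hL₁, hle₁⟩ := lip hf h0
  have hswap : ContDiffAt ℝ 3 (fun p : E × E ↦ f (p.2, p.1)) 0 :=
    ContDiffAt.comp (0 : E × E) (f := fun p : E × E ↦ (p.2, p.1)) hf
      (contDiff_snd.prodMk contDiff_fst).contDiffAt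
  obtain ⟨δ₂, hδ₂, L₂, hL₂, hle₂⟩ := lip hswap h0'
  obtain ⟨δ₃, hδ₃, hid⟩ := Metric.eventually_nhds_iff.1 h0'
  simp only [dist_zero_right] at hid
  set B := mixedDeriv f
  refine ⟨min (min δ δ₃) (min δ₁ δ₂), by positivity, K + L₁ + L₂ + ‖B‖, by positivity, ?_, ?_, ?_, ?_⟩
  · intro x x' y hx hx' hy
    simp only [lt_min_iff] at hx hx' hy
    refine (hle₂ y x x' hy.2.2 hx.2.2 hx'.2.2).trans ?_
    rw [mul_right_comm]
    gcongr
    linarith [norm_nonneg B]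
  · intro x y y' hx hy hy'
    simp only [lt_min_iff] at hx hy hy'
    refine (hle₁ x y y' hx.2.1 hy.2.1 hy'.2.1).trans ?_
    gcongr
    linarith [norm_nonneg B]
  · intro x y hx hy
    simp only [lt_min_iff] at hx hy
    have h := hle x y 0 hx.1.1 hy.1.1 (by simpa using hδ)
    rw [hid hx.1.2, sub_zero, norm_zero, max_eq_left (norm_nonneg y)] at h
    rw [show f (x, y) - (x + y + B x y) = f (x, y) - x - y - B x y by abel]
    refine h.trans ?_
    rw [mul_right_comm, mul_right_comm, mul_right_comm K, mul_right_comm (K * _)]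
    have : max ‖x‖ ‖y‖ ≤ ‖x‖ + ‖y‖ := max_le_add_of_nonneg (norm_nonneg _) (norm_nonneg _)
    have h5 : K ≤ K + L₁ + L₂ + ‖B‖ := by linarith [norm_nonneg B]
    calc K * ‖x‖ * ‖y‖ * max ‖x‖ ‖y‖ ≤ (K + L₁ + L₂ + ‖B‖) * ‖x‖ * ‖y‖ * (‖x‖ + ‖y‖) := by gcongr
      _ = _ := by ring
  · intro x y
    refine (B.le_opNorm₂ x y).trans ?_
    gcongr
    linarith

theorem exists_logEstimates {G : Type*} [Group G] {e : E → G} {l : G → E} {V₀ : Set G}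
    (N : Seminorm ℝ E) {M : ℝ} (hN : ∀ x, N x ≤ M * ‖x‖) (hN' : ∀ x, ‖x‖ ≤ M * N x)
    (log_exp : ∀ᶠ x in 𝓝 0, l (e x) = x) (exp_mem : ∀ᶠ x in 𝓝 0, e x ∈ V₀)
    (exp_log : ∀ g ∈ V₀, e (l g) = g)
    (exp_add_smul : ∀ (s t : ℝ) x, e ((s + t) • x) = e (s • x) * e (t • x))
    (mul_mem : ∀ᶠ p : E × E in 𝓝 0, e p.1 * e p.2 ∈ V₀)
    (hsmooth : ContDiffAt ℝ 3 (fun p : E × E ↦ l (e p.1 * e p.2)) 0) :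
    ∃ r C, LogEstimates N (ContinuousLinearMap.coeLM ℝ ∘ₗ
      (mixedDeriv fun p : E × E ↦ l (e p.1 * e p.2)).toLinearMap) e l V₀ r C := by
  set f : E × E → E := fun p ↦ l (e p.1 * e p.2) with hf
  have e0 : e 0 = 1 := by simpa using exp_add_smul 0 0 0
  have h0 : ∀ᶠ y in 𝓝 0, f (0, y) = y := log_exp.mono fun y hy ↦ by simpa [hf, e0] using hy
  have h0' : ∀ᶠ x in 𝓝 0, f (x, 0) = x := log_exp.mono fun y hy ↦ by simpa [hf, e0] using hy
  have hdiag : ∀ᶠ x in 𝓝 0, f (x, x) = (2 : ℝ) • x := by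
    have hc : Continuous fun x : E ↦ (2 : ℝ) • x := continuous_const_smul _
    have ht := hc.tendsto 0
    rw [smul_zero] at ht
    filter_upwards [ht.eventually log_exp] with x hx
    have := exp_add_smul 1 1 x
    rw [one_smul, one_add_one_eq_two] at this
    change l (e x * e x) = _
    rw [← this]
    exact hx
  obtain ⟨δ₁, hδ₁, L, hL, hl, hr, hb, ha⟩ := hsmooth.exists_bch_bounds h0 h0'
  obtain ⟨δ₂, hδ₂, hle⟩ := Metric.eventually_nhds_iff.1 (log_exp.and exp_mem)
  obtain ⟨δ₃, hδ₃, hmem⟩ := Metric.eventually_nhds_iff.1 mul_mem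
  simp only [dist_zero_right] at hle hmem
  set B := mixedDeriv f
  set D := max M 1 with hD
  have hD1 : 1 ≤ D := le_max_right _ _
  have hDN : ∀ x, N x ≤ D * ‖x‖ := fun x ↦ (hN x).trans (by gcongr; exact le_max_left _ _)
  have hDN' : ∀ x, ‖x‖ ≤ D * N x := fun x ↦ (hN' x).trans
    (mul_le_mul_of_nonneg_right (le_max_left _ _) (apply_nonneg _ _))
  set C := L * D ^ 4 with hC
  have hC0 : 0 ≤ C := by positivity
  set r := min 1 (min (min δ₁ (min δ₂ δ₃) / D) (1 / (16 * (C + 1)))) with hr'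
  have hr0 : 0 < r := by positivity
  have hlt : ∀ x, N x < r → ‖x‖ < δ₁ ∧ ‖x‖ < δ₂ ∧ ‖x‖ < δ₃ := by
    intro x hx
    have h1 : N x < min δ₁ (min δ₂ δ₃) / D :=
      hx.trans_le ((min_le_right _ _).trans (min_le_left _ _))
    rw [lt_div_iff₀ (by positivity)] at h1
    have := hDN' x
    rw [← lt_min_iff, ← lt_min_iff]
    linarith
  have hC3 : L * D ^ 3 ≤ C := by
    rw [hC]; gcongr; norm_num
  have bound : ∀ {x y z : E}, ‖z‖ ≤ L * ‖x‖ * ‖y‖ → N z ≤ C * N x * N y := by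
    intro x y z hz
    calc N z ≤ D * (L * ‖x‖ * ‖y‖) := (hDN z).trans (by gcongr)
      _ ≤ D * (L * (D * N x) * (D * N y)) := by gcongr <;> exact hDN' _
      _ = L * D ^ 3 * N x * N y := by ring
      _ ≤ C * N x * N y := by gcongr
  refine ⟨r, C, ?_⟩
  constructor
  · exact hr0
  · exact min_le_left _ _
  · exact hC0
  · have h1 : r ≤ 1 / (16 * (C + 1)) := (min_le_right _ _).trans (min_le_right _ _)
    rw [le_div_iff₀ (by positivity)] at h1
    linarith
  · intro x hx
    have := hDN' x
    rw [hx, mul_zero] at this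
    exact norm_le_zero_iff.1 this
  · exact fun x hx ↦ (hle (hlt x hx).2.1).1
  · exact fun x hx ↦ (hle (hlt x hx).2.1).2
  · exact exp_log
  · exact exp_add_smul
  · exact fun x y hx hy ↦ hmem (y := (x, y)) (max_lt (hlt x hx).2.2 (hlt y hy).2.2)
  · exact fun x x' y hx hx' hy ↦ bound (hl x x' y (hlt x hx).1 (hlt x' hx').1 (hlt y hy).1)
  · exact fun x y y' hx hy hy' ↦ bound (hr x y y' (hlt x hx).1 (hlt y hy).1 (hlt y' hy').1)
  · intro x y hx hy
    calc N (f (x, y) - (x + y + B x y)) ≤ D * (L * ‖x‖ * ‖y‖ * (‖x‖ + ‖y‖)) :=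
          (hDN _).trans (by gcongr; exact hb x y (hlt x hx).1 (hlt y hy).1)
      _ ≤ D * (L * (D * N x) * (D * N y) * (D * N x + D * N y)) := by gcongr <;> exact hDN' _
      _ = C * N x * N y * (N x + N y) := by ring
  · exact mixedDeriv_isAlt hsmooth h0 h0' hdiag
  · exact fun x y _ _ ↦ bound (ha x y)

end Calculus

section LieGroupExponential

variable {E : Type*} [NormedAddCommGroup E] [NormedSpace ℝ E] [FiniteDimensional ℝ E]
  {H : Type*} [TopologicalSpace H] {I : ModelWithCorners ℝ E H} [I.Boundaryless]
  {G : Type*} [TopologicalSpace G] [ChartedSpace H G] [Group G] [LieGroup I ∞ G]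

omit [FiniteDimensional ℝ E] [I.Boundaryless] in
theorem mfderiv_mul_left_mulInvariantVectorField (v : GroupLieAlgebra I G) (g h : G) :
    mfderiv I I (fun b : G ↦ g * b) h (mulInvariantVectorField v h) =
      mulInvariantVectorField v (g * h) := by
  have hd : ∀ g h : G, MDifferentiableAt I I (fun b : G ↦ g * b) h := fun g h ↦
    ((contMDiff_mul_left (I := I) (n := ∞) (a := g)).mdifferentiable (by simp)) h
  have hc : (fun b : G ↦ g * h * b) = (fun b : G ↦ g * b) ∘ (fun b : G ↦ h * b) := by
    ext b; simp [mul_assoc]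
  have hd' : MDifferentiableAt I I (fun b : G ↦ g * b) (h * 1) := hd g _
  have h1 := mfderiv_comp (1 : G) hd' (hd h 1)
  rw [← hc] at h1
  have hk : ∀ k : G, k = h → ∀ w : E,
      (mfderiv I I (fun b : G ↦ g * b) h : E →L[ℝ] E) w =
        (mfderiv I I (fun b : G ↦ g * b) k : E →L[ℝ] E) w := by
    rintro k rfl w; rfl
  refine (hk (h * 1) (mul_one h) _).trans ?_
  exact (DFunLike.congr_fun h1 v).symm

omit [FiniteDimensional ℝ E] [I.Boundaryless] in
theorem IsMIntegralCurve.mul_left {v : GroupLieAlgebra I G} {γ : ℝ → G}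
    (hγ : IsMIntegralCurve (I := I) γ (mulInvariantVectorField v)) (g : G) :
    IsMIntegralCurve (I := I) (fun t ↦ g * γ t) (mulInvariantVectorField v) := by
  intro t
  have hd : MDifferentiableAt I I (fun b : G ↦ g * b) (γ t) :=
    ((contMDiff_mul_left (I := I) (n := ∞) (a := g)).mdifferentiable (by simp)) _
  have h2 := hd.hasMFDerivAt.comp t (hγ t)
  have e : ContinuousLinearMap.smulRight (1 : ℝ →L[ℝ] ℝ)
      (mulInvariantVectorField (I := I) v (g * γ t) : E) =
      (mfderiv I I (fun b : G ↦ g * b) (γ t) : E →L[ℝ] E).comp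
        (ContinuousLinearMap.smulRight (1 : ℝ →L[ℝ] ℝ)
          (mulInvariantVectorField (I := I) v (γ t) : E)) := by
    refine ContinuousLinearMap.ext fun r ↦ ?_
    refine (congrArg (fun w : E ↦ r • w)
      (mfderiv_mul_left_mulInvariantVectorField v g (γ t)).symm).trans ?_
    exact ((mfderiv I I (fun b : G ↦ g * b) (γ t) : E →L[ℝ] E).map_smul r
      (mulInvariantVectorField (I := I) v (γ t) : E)).symm
  exact HasMFDerivAt.congr_mfderiv h2 e.symm

theorem isMIntegralCurve_lieExp_smul (v : GroupLieAlgebra I G) :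
    IsMIntegralCurve (I := I) (fun t : ℝ ↦ lieExp I (t • v)) (mulInvariantVectorField v) := by
  obtain ⟨γ, h0, hγ⟩ := exists_isMIntegralCurve_mulInvariantVectorField I v
  have h3 : LieGroup I (minSmoothness ℝ 3) G := by
    rw [minSmoothness_of_isRCLikeNormedField]; infer_instance
  have : (fun t : ℝ ↦ lieExp I (t • v)) = γ := by
    ext t
    have h := hγ.comp_mul t
    rw [← mulInvariantVectorField_smul] at h
    refine (lieExp_eq_of_isMIntegralCurve I (t • v) _ (by simpa using h0) h).trans ?_
    simp
  rwa [this]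

theorem lieExp_zero : lieExp (G := G) I 0 = 1 := by
  obtain ⟨γ, h0, hγ⟩ := exists_isMIntegralCurve_mulInvariantVectorField (G := G) I 0
  have h := hγ.comp_mul 0
  have h3 : LieGroup I (minSmoothness ℝ 3) G := by
    rw [minSmoothness_of_isRCLikeNormedField]; infer_instance
  rw [← mulInvariantVectorField_smul, smul_zero] at h
  refine (lieExp_eq_of_isMIntegralCurve I 0 _ (by simpa using h0) h).trans ?_
  simpa using h0

theorem lieExp_add_smul (s t : ℝ) (v : GroupLieAlgebra I G) :
    lieExp I ((s + t) • v) = lieExp I (s • v) * lieExp I (t • v) := by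
  have h3 : LieGroup I (minSmoothness ℝ 3) G := by
    rw [minSmoothness_of_isRCLikeNormedField]; infer_instance
  have : CompleteSpace E := FiniteDimensional.complete ℝ E
  have : IsManifold I 1 G := IsManifold.of_le (n := ∞) (by simp)
  have : IsTopologicalGroup G := topologicalGroup_of_lieGroup I ∞
  have : T1Space G := I.t1Space G
  have hv : ContMDiff I I.tangent 1
      (fun g : G ↦ (⟨g, mulInvariantVectorField v g⟩ : TangentBundle I G)) :=
    (contMDiff_mulInvariantVectorField v).of_le
      (by rw [minSmoothness_of_isRCLikeNormedField]; exact one_le_two)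
  have h := isMIntegralCurve_lieExp_smul v
  have := isMIntegralCurve_Ioo_eq_of_contMDiff_boundaryless (t₀ := 0) hv
    (h.comp_add s) (h.mul_left (lieExp I (s • v))) (by simp [lieExp_zero])
  have := congrFun this t
  simpa [add_comm] using this

variable (I G) in
/-- The exponential map, as a map on the model space. -/
noncomputable def modelExp : E → G := fun v ↦ lieExp (G := G) I v

/-- The logarithm, as a map to the model space. -/
noncomputable def modelLog (U : Set (GroupLieAlgebra I G)) : G → E := lieLog I U

/-- The group law in exponential coordinates. -/
noncomputable def modelMul (U : Set (GroupLieAlgebra I G)) : E × E → E :=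
  fun p ↦ modelLog U (modelExp I G p.1 * modelExp I G p.2)

theorem modelExp_zero : modelExp I G 0 = 1 := lieExp_zero

namespace IsLogDomain

variable {U : Set (GroupLieAlgebra I G)} {V : Set G} (hU : IsLogDomain I U V)
include hU

theorem modelLog_modelExp {v : E} (hv : v ∈ U) : modelLog U (modelExp I G v) = v :=
  hU.injOn.leftInvOn_invFunOn hv

theorem modelExp_modelLog {g : G} (hg : g ∈ V) : modelExp I G (modelLog U g) = g := by
  rw [← hU.image_eq] at hg
  exact Function.invFunOn_eq hg

theorem modelExp_mem {v : E} (hv : v ∈ U) : modelExp I G v ∈ V :=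
  hU.image_eq ▸ Set.mem_image_of_mem _ hv

theorem source_mem_nhds {v : E} (hv : v ∈ U) : U ∈ 𝓝 v := hU.isOpen_source.mem_nhds hv

theorem contMDiffAt_modelExp {v : E} (hv : v ∈ U) : ContMDiffAt 𝓘(ℝ, E) I ∞ (modelExp I G) v :=
  ContMDiffOn.contMDiffAt (M := E) hU.contMDiffOn_exp (hU.source_mem_nhds hv)

theorem contMDiffAt_modelLog {g : G} (hg : g ∈ V) : ContMDiffAt I 𝓘(ℝ, E) ∞ (modelLog U) g :=
  ContMDiffOn.contMDiffAt (M' := E) hU.contMDiffOn_log (hU.isOpen_target.mem_nhds hg)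

theorem contMDiffAt_mul_modelExp :
    ContMDiffAt 𝓘(ℝ, E × E) I ∞ (fun p : E × E ↦ modelExp I G p.1 * modelExp I G p.2) 0 := by
  have h1 : ContMDiffAt 𝓘(ℝ, E × E) I ∞ (fun p : E × E ↦ modelExp I G p.1) 0 :=
    ContMDiffAt.comp (0 : E × E) (g := modelExp I G) (f := Prod.fst)
      (hU.contMDiffAt_modelExp hU.zero_mem) contDiff_fst.contMDiff.contMDiffAt
  have h2 : ContMDiffAt 𝓘(ℝ, E × E) I ∞ (fun p : E × E ↦ modelExp I G p.2) 0 :=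
    ContMDiffAt.comp (0 : E × E) (g := modelExp I G) (f := Prod.snd)
      (hU.contMDiffAt_modelExp hU.zero_mem) contDiff_snd.contMDiff.contMDiffAt
  exact h1.mul h2

theorem one_mem : (1 : G) ∈ V := modelExp_zero (I := I) (G := G) ▸ hU.modelExp_mem hU.zero_mem

theorem eventually_mul_mem :
    ∀ᶠ p : E × E in 𝓝 0, modelExp I G p.1 * modelExp I G p.2 ∈ V := by
  refine hU.contMDiffAt_mul_modelExp.continuousAt.eventually (hU.isOpen_target.mem_nhds ?_)
  simpa [modelExp_zero] using hU.one_mem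

theorem contDiffAt_modelMul : ContDiffAt ℝ ∞ (modelMul U) 0 := by
  rw [← contMDiffAt_iff_contDiffAt]
  exact ContMDiffAt.comp (0 : E × E) (g := modelLog U)
    (hU.contMDiffAt_modelLog hU.eventually_mul_mem.self_of_nhds) hU.contMDiffAt_mul_modelExp

open VectorField

theorem inverse_mfderiv_modelExp {x : E} (hx : x ∈ U) :
    (mfderiv 𝓘(ℝ, E) I (modelExp I G) x).inverse =
      mfderiv I 𝓘(ℝ, E) (modelLog U) (modelExp I G x) := by
  have he : MDifferentiableAt 𝓘(ℝ, E) I (modelExp I G) x :=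
    (hU.contMDiffAt_modelExp hx).mdifferentiableAt (by simp)
  have hl : MDifferentiableAt I 𝓘(ℝ, E) (modelLog U) (modelExp I G x) :=
    (hU.contMDiffAt_modelLog (hU.modelExp_mem hx)).mdifferentiableAt (by simp)
  have hlx : modelLog U (modelExp I G x) = x := hU.modelLog_modelExp hx
  apply ContinuousLinearMap.inverse_eq
  · have he' : MDifferentiableAt 𝓘(ℝ, E) I (modelExp I G) (modelLog U (modelExp I G x)) := by
      rwa [hlx]
    have h1 := mfderiv_comp (modelExp I G x) he' hl
    have h2 : modelExp I G ∘ modelLog U =ᶠ[𝓝 (modelExp I G x)] id := by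
      filter_upwards [hU.isOpen_target.mem_nhds (hU.modelExp_mem hx)] with g hg
        using hU.modelExp_modelLog hg
    rw [h2.mfderiv_eq, mfderiv_id] at h1
    rw [hlx] at h1
    exact h1.symm
  · have h1 := mfderiv_comp x hl he
    have h2 : modelLog U ∘ modelExp I G =ᶠ[𝓝 x] id := by
      filter_upwards [hU.source_mem_nhds hx] with v hv using hU.modelLog_modelExp hv
    rw [h2.mfderiv_eq, mfderiv_id] at h1
    exact h1.symm

theorem hasDerivAt_modelLog_comp {v : GroupLieAlgebra I G} {γ : ℝ → G}
    (hγ : IsMIntegralCurve (I := I) γ (mulInvariantVectorField v)) {g : G} (h0 : γ 0 = g)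
    (hg : g ∈ V) :
    HasDerivAt (F := E) (fun t ↦ modelLog U (γ t))
      (mfderiv I 𝓘(ℝ, E) (modelLog U) g (mulInvariantVectorField v g)) 0 := by
  subst h0
  have hl : MDifferentiableAt I 𝓘(ℝ, E) (modelLog U) (γ 0) :=
    (hU.contMDiffAt_modelLog hg).mdifferentiableAt (by simp)
  have h := hl.hasMFDerivAt.comp (0 : ℝ) (hγ 0)
  let D : E →L[ℝ] E := mfderiv I 𝓘(ℝ, E) (modelLog U) (γ 0)
  let x : E := mulInvariantVectorField (I := I) v (γ 0)
  have h' : HasFDerivAt (F := E) (fun t ↦ modelLog U (γ t))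
      (D.comp (ContinuousLinearMap.smulRight (1 : ℝ →L[ℝ] ℝ) x)) 0 :=
    hasMFDerivAt_iff_hasFDerivAt.1 h
  refine h'.hasDerivAt.congr_deriv ?_
  change D ((1 : ℝ) • x) = D x
  rw [one_smul]

theorem eventually_mpullback_modelExp (v : E) :
    ∀ᶠ x : E in 𝓝 0, mpullback 𝓘(ℝ, E) I (modelExp I G)
      (mulInvariantVectorField (v : GroupLieAlgebra I G)) x =
      fderiv ℝ (modelMul U) (x, 0) (0, v) := by
  have hd : ∀ᶠ p : E × E in 𝓝 0, DifferentiableAt ℝ (modelMul U) p :=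
    ((hU.contDiffAt_modelMul.of_le (m := 1) (by simp)).eventually (by simp)).mono
      fun p hp ↦ hp.differentiableAt (by simp)
  have ht : Filter.Tendsto (fun x : E ↦ (x, (0 : E))) (𝓝 0) (𝓝 0) :=
    (Continuous.prodMk_left (0 : E)).tendsto (0 : E)
  filter_upwards [hU.source_mem_nhds hU.zero_mem, ht.eventually hd] with x hx hdx
  rw [mpullback_apply, hU.inverse_mfderiv_modelExp hx]
  have hx0 : modelExp I G x * modelExp I G ((0 : ℝ) • v) = modelExp I G x := by
    rw [zero_smul, modelExp_zero, mul_one]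
  have h1 := hU.hasDerivAt_modelLog_comp
    ((isMIntegralCurve_lieExp_smul (v : GroupLieAlgebra I G)).mul_left (modelExp I G x))
    (g := modelExp I G x) hx0 (hU.modelExp_mem hx)
  have hline : HasDerivAt (fun t : ℝ ↦ (x, t • v)) (0, v) 0 := by
    have := (hasDerivAt_const (0 : ℝ) x).prodMk ((hasDerivAt_id (0 : ℝ)).smul_const v)
    simpa using this
  have hdx' : DifferentiableAt ℝ (modelMul U) (x, (0 : ℝ) • v) := by
    rw [zero_smul]; exact hdx
  have h2 := hdx'.hasFDerivAt.comp_hasDerivAt (0 : ℝ) hline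
  rw [zero_smul] at h2
  exact h1.unique h2

theorem modelMul_zero_left : ∀ᶠ y : E in 𝓝 0, modelMul U (0, y) = y := by
  filter_upwards [hU.source_mem_nhds hU.zero_mem] with y hy
  simpa [modelMul, modelExp_zero] using hU.modelLog_modelExp hy

theorem fderiv_modelMul_zero (v : E) : fderiv ℝ (modelMul U) 0 (0, v) = v := by
  have hd : DifferentiableAt ℝ (modelMul U) ((0 : E), (0 : E)) :=
    hU.contDiffAt_modelMul.differentiableAt (by simp)
  have h1 := hd.hasFDerivAt.comp (0 : E) (hasFDerivAt_prodMk_right (0 : E) (0 : E))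
  have h2 := (hasFDerivAt_id (𝕜 := ℝ) (0 : E)).congr_of_eventuallyEq hU.modelMul_zero_left
  exact DFunLike.congr_fun (h1.unique h2) v

theorem fderiv_mpullback_modelExp (v w : E) :
    fderiv ℝ (fun x : E ↦ fderiv ℝ (modelMul U) (x, 0) (0, v)) 0 w =
      mixedDeriv (modelMul U) w v := by
  set P : E × E → E →L[ℝ] E :=
    fun p ↦ (fderiv ℝ (modelMul U) p).comp (ContinuousLinearMap.inr ℝ E E) with hP
  have hP1 : ContDiffAt ℝ 1 P ((0 : E), (0 : E)) :=
    ((hU.contDiffAt_modelMul.of_le (m := 2) (by norm_cast)).fderiv_right (m := 1)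
      (by norm_num)).clm_comp contDiffAt_const
  have h1 := (hP1.differentiableAt (by simp)).hasFDerivAt.comp (0 : E) (f := fun x : E ↦ (x, (0 : E)))
    (hasFDerivAt_prodMk_left (0 : E) (0 : E))
  have h2 := h1.clm_apply (hasFDerivAt_const v (0 : E))
  have h3 : (fun x : E ↦ fderiv ℝ (modelMul U) (x, 0) (0, v)) =
      fun y ↦ (P ∘ fun e : E ↦ (e, (0 : E))) y v := by
    ext x; simp [hP]
  rw [h3, h2.fderiv]
  simp [mixedDeriv, hP]
  rfl

theorem bracket_eq (v w : GroupLieAlgebra I G) :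
    ⁅v, w⁆ =
      mixedDeriv (modelMul U) v w - mixedDeriv (modelMul U) w v := by
  have h3 : LieGroup I (minSmoothness ℝ 3) G := by
    rw [minSmoothness_of_isRCLikeNormedField]; infer_instance
  have : CompleteSpace E := FiniteDimensional.complete ℝ E
  set b : GroupLieAlgebra I G := ⁅v, w⁆ with hb
  have h1 := mpullback_mlieBracket (I := 𝓘(ℝ, E)) (I' := I) (n := minSmoothness ℝ 3)
    (f := modelExp I G) (x₀ := (0 : E))
    (V := mulInvariantVectorField (v : GroupLieAlgebra I G))
    (W := mulInvariantVectorField (w : GroupLieAlgebra I G))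
    (mdifferentiableAt_mulInvariantVectorField _) (mdifferentiableAt_mulInvariantVectorField _)
    ((hU.contMDiffAt_modelExp hU.zero_mem).of_le
      (by rw [minSmoothness_of_isRCLikeNormedField]; norm_cast))
    (minSmoothness_monotone (by norm_cast))
  rw [← mulInvariantVector_mlieBracket, ← GroupLieAlgebra.bracket_def, ← hb,
    (hU.eventually_mpullback_modelExp b).self_of_nhds,
    Filter.EventuallyEq.mlieBracket_vectorField_eq (hU.eventually_mpullback_modelExp v)
      (hU.eventually_mpullback_modelExp w)] at h1
  have hlie : ∀ V W : E → E, mlieBracket 𝓘(ℝ, E) V W (0 : E) = lieBracket ℝ V W 0 := fun V W ↦ by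
    rw [← lieBracketWithin_univ]
    exact (congrFun mlieBracketWithin_univ 0).symm.trans
      (congrFun mlieBracketWithin_eq_lieBracketWithin 0)
  refine (hU.fderiv_modelMul_zero b).symm.trans (h1.trans ((hlie _ _).trans ?_))
  have hv := hU.fderiv_modelMul_zero v
  have hw := hU.fderiv_modelMul_zero w
  have hvw := hU.fderiv_mpullback_modelExp v w
  have hwv := hU.fderiv_mpullback_modelExp w v
  change fderiv ℝ (fun x : E ↦ fderiv ℝ (modelMul U) (x, 0) (0, w)) 0
      (fderiv ℝ (modelMul U) 0 (0, v)) -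
    fderiv ℝ (fun x : E ↦ fderiv ℝ (modelMul U) (x, 0) (0, v)) 0
      (fderiv ℝ (modelMul U) 0 (0, w)) = _
  rw [hv, hw, hvw, hwv]

end IsLogDomain

end LieGroupExponential

theorem LinearEquiv.exists_norm_le {E F : Type*} [NormedAddCommGroup E] [NormedSpace ℝ E]
    [FiniteDimensional ℝ E] [NormedAddCommGroup F] [NormedSpace ℝ F] (L : E ≃ₗ[ℝ] F) :
    ∃ M : ℝ, ∀ x, ‖L x‖ ≤ M * ‖x‖ ∧ ‖x‖ ≤ M * ‖L x‖ := by
  have : FiniteDimensional ℝ F := L.finiteDimensional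
  let T := L.toContinuousLinearEquiv
  refine ⟨max ‖(T : E →L[ℝ] F)‖ ‖(T.symm : F →L[ℝ] E)‖, fun x ↦ ⟨?_, ?_⟩⟩
  · exact ((T : E →L[ℝ] F).le_opNorm x).trans (by gcongr; exact le_max_left _ _)
  · have h := (T.symm : F →L[ℝ] E).le_opNorm (T x)
    have hx : (T.symm : F →L[ℝ] E) (T x) = x := T.symm_apply_apply x
    rw [hx] at h
    exact h.trans (by gcongr; exact le_max_right _ _; exact le_rfl)

/-- The euclidean norm of an inner product, as a seminorm. -/
noncomputable def euclideanSeminorm {V : Type*} [AddCommGroup V] [Module ℝ V]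
    (ip : InnerProductSpace.Core ℝ V) : Seminorm ℝ V :=
  letI := ip.toNormedAddCommGroup
  letI : NormedSpace ℝ V := @InnerProductSpace.Core.toNormedSpace ℝ V _ _ _ ip.toCore
  { toFun := euclideanNorm ip
    map_zero' := norm_zero (E := V)
    add_le' := norm_add_le (E := V)
    neg' := norm_neg (E := V)
    smul' := norm_smul (β := V) }

theorem exists_euclideanNorm_le {E : Type*} [NormedAddCommGroup E] [NormedSpace ℝ E]
    [FiniteDimensional ℝ E] (ip : InnerProductSpace.Core ℝ E) :
    ∃ M : ℝ, ∀ x, euclideanNorm ip x ≤ M * ‖x‖ ∧ ‖x‖ ≤ M * euclideanNorm ip x :=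
  @LinearEquiv.exists_norm_le E E _ _ _ ip.toNormedAddCommGroup
    (@InnerProductSpace.Core.toNormedSpace ℝ E _ _ _ ip.toCore)
    (LinearEquiv.refl ℝ E)

theorem IsLogDomain.exists_logEstimates {E : Type*} [NormedAddCommGroup E] [NormedSpace ℝ E]
    [FiniteDimensional ℝ E] {H : Type*} [TopologicalSpace H] {I : ModelWithCorners ℝ E H}
    [I.Boundaryless] {G : Type*} [TopologicalSpace G] [ChartedSpace H G] [Group G]
    [LieGroup I ∞ G] {U : Set (GroupLieAlgebra I G)} {V : Set G} (hU : IsLogDomain I U V)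
    (ip : InnerProductSpace.Core ℝ E) :
    ∃ r C, LogEstimates (euclideanSeminorm ip)
      (ContinuousLinearMap.coeLM ℝ ∘ₗ (mixedDeriv (modelMul U)).toLinearMap)
      (modelExp I G) (modelLog U) V r C := by
  obtain ⟨M, hM⟩ := exists_euclideanNorm_le ip
  have hsource : ∀ᶠ x : E in 𝓝 0, x ∈ U := hU.source_mem_nhds hU.zero_mem
  exact _root_.exists_logEstimates (euclideanSeminorm ip) (fun x ↦ (hM x).1) (fun x ↦ (hM x).2)
    (hsource.mono fun x hx ↦ hU.modelLog_modelExp hx) (hsource.mono fun x hx ↦ hU.modelExp_mem hx)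
    (fun g hg ↦ hU.modelExp_modelLog hg) (fun s t x ↦ lieExp_add_smul s t x)
    hU.eventually_mul_mem (hU.contDiffAt_modelMul.of_le (by norm_cast))

theorem mainTheorem7
    {E : Type*} [NormedAddCommGroup E] [NormedSpace ℝ E] [FiniteDimensional ℝ E]
    {H : Type*} [TopologicalSpace H] (I : ModelWithCorners ℝ E H) [I.Boundaryless]
    {G : Type*} [TopologicalSpace G] [ChartedSpace H G] [Group G] [LieGroup I ∞ G]
    (U₀ : Set (GroupLieAlgebra I G)) (V₀ : Set G) (hV₀ : IsLogDomain I U₀ V₀)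
    (ip : InnerProductSpace.Core ℝ (GroupLieAlgebra I G)) :
    ∃ ε₀ c₀ : ℝ,
      -- (i)
      (0 < ε₀ ∧ ε₀ ≤ 1 ∧ 0 ≤ c₀) ∧
      -- (ii)
      (∀ (m : ℕ) (α : Fin m → GroupLieAlgebra I G),
        ∑ i, euclideanNorm ip (α i) < ε₀ →
          (List.ofFn fun i ↦ lieExp I (α i)).prod ∈ V₀ ∧
          euclideanNorm ip (lieLog I U₀ (List.ofFn fun i ↦ lieExp I (α i)).prod) ≤
            c₀ * ∑ i, euclideanNorm ip (α i) ∧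
          euclideanNorm ip (lieLog I U₀ (List.ofFn fun i ↦ lieExp I (α i)).prod - ∑ i, α i) ≤
            c₀ * (∑ i, euclideanNorm ip (α i)) ^ 2) ∧
      -- (iii)
      (∀ α₁ α₂ : GroupLieAlgebra I G,
        euclideanNorm ip α₁ + euclideanNorm ip α₂ < ε₀ →
          euclideanNorm ip ⁅α₁, α₂⁆ ≤ c₀ * euclideanNorm ip α₁ * euclideanNorm ip α₂ ∧
          lieExp I α₁ * lieExp I α₂ ∈ V₀ ∧
          euclideanNorm ip (lieLog I U₀ (lieExp I α₁ * lieExp I α₂) -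
              (α₁ + α₂ + (1 / 2 : ℝ) • ⁅α₁, α₂⁆)) ≤
            c₀ * euclideanNorm ip α₁ * euclideanNorm ip α₂ *
              (euclideanNorm ip α₁ + euclideanNorm ip α₂) ∧
          lieExp I α₁ * lieExp I α₂ * (lieExp I α₁)⁻¹ * (lieExp I α₂)⁻¹ ∈ V₀ ∧
          euclideanNorm ip
              (lieLog I U₀ (lieExp I α₁ * lieExp I α₂ * (lieExp I α₁)⁻¹ * (lieExp I α₂)⁻¹) -
                ⁅α₁, α₂⁆) ≤
            c₀ * euclideanNorm ip α₁ * euclideanNorm ip α₂ *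
              (euclideanNorm ip α₁ + euclideanNorm ip α₂)) ∧
      (∀ (m : ℕ) (α β : Fin m → GroupLieAlgebra I G),
        ∑ i, (euclideanNorm ip (α i) + euclideanNorm ip (β i)) < ε₀ →
          -- (iv); the two products lie in `V₀` by (ii)
          euclideanNorm ip
              (lieLog I U₀ (List.ofFn fun i ↦ lieExp I (α i + β i)).prod -
                lieLog I U₀ (List.ofFn fun i ↦ lieExp I (α i)).prod - ∑ i, β i) ≤
            c₀ * (∑ i, (euclideanNorm ip (α i) + euclideanNorm ip (β i))) *
              ∑ i, euclideanNorm ip (β i) ∧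
          euclideanNorm ip
              (lieLog I U₀ (List.ofFn fun i ↦ lieExp I (α i + β i)).prod -
                lieLog I U₀ (List.ofFn fun i ↦ lieExp I (α i)).prod) ≤
            c₀ * ∑ i, euclideanNorm ip (β i) ∧
          -- (v)
          ((∀ i j, ⁅α i, α j⁆ = 0) →
            euclideanNorm ip
                (lieLog I U₀ (List.ofFn fun i ↦ lieExp I (α i + β i)).prod -
                  ∑ i, (α i + β i)) ≤
              c₀ * (∑ i, (euclideanNorm ip (α i) + euclideanNorm ip (β i))) *
                ∑ i, euclideanNorm ip (β i))) := by
  obtain ⟨r, C, h⟩ := hV₀.exists_logEstimates ip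
  refine h.exists_constants
    (fun v w : GroupLieAlgebra I G ↦ (⁅v, w⁆ : GroupLieAlgebra I G)) fun v w ↦ ?_
  refine (hV₀.bracket_eq v w).trans ?_
  have hneg := h.isAlt.neg v w
  change -(mixedDeriv (modelMul U₀) v w) = mixedDeriv (modelMul U₀) w v at hneg
  change mixedDeriv (modelMul U₀) v w - mixedDeriv (modelMul U₀) w v =
    (2 : ℝ) • mixedDeriv (modelMul U₀) v w
  rw [← hneg, sub_neg_eq_add, two_smul]
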